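/- **Setting.** Let $k$ be a field. A *variety* over $k$ is a separated scheme of finite type over $k$. An invertible sheaf $\mathcal{L}$ on a noetherian scheme $X$ is *ample* if for every coherent sheaf $\mathcal{M}$ on $X$ there is $n_0$ such that $\mathcal{M}\otimes\mathcal{L}^{\otimes n}$ is generated by its global sections for all $n\ge n_0$. Locally free sheaves of finite rank may have a rank that varies with the point; for such a sheaf $\mathcal F$, the condition $i>\mathrm{rk}(\mathcal{F})$ means that $i$ exceeds the rank of $\mathcal{F}$ at every point. For a scheme $X$ let $K(X)$ be the Grothendieck ring of finite rank locally free sheaves on $X$: as a group it is generated by classes $[\mathcal{F}]$, with relations $[\mathcal{G}]=[\mathcal{E}]+[\mathcal{F}]$ for short exact sequences $0\to\mathcal{E}\to\mathcal{G}\to\mathcal{F}\to0$. Only this group structure is used below. Let $\mathbb{Z}[R_X]$ be the polynomial ring on symbols $c_i(\mathcal{F})$, where $i\ge0$ and $\mathcal{F}$ runs over the finite rank locally free sheaves on $X$, and let $I_X\subset\mathbb{Z}[R_X]$ be the ideal generated by - $c_0(\mathcal{F})-1$ for all $\mathcal{F}$; - $c_i(\mathcal{F})$ for all $\mathcal F$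 and all $i>\mathrm{rk}(\mathcal{F})$; - $c_i(\mathcal{G})-\sum_{j=0}^i c_{i-j}(\mathcal{F})\,c_j(\mathcal{E})$ for all $i\ge 0$ and all short exact sequences $0\to\mathcal{E}\to\mathcal{G}\to\mathcal{F}\to0$; - $c_1(\mathcal{L}\otimes\mathcal{L}')-c_1(\mathcal{L})-c_1(\mathcal{L}')$ for all invertible sheaves $\mathcal{L},\mathcal{L}'$. A morphism $f:P\to X$ induces $f^*:\mathbb{Z}[R_X]\to\mathbb{Z}[R_P]$, $c_i(\mathcal{F})\mapsto c_i(f^*\mathcal{F})$. A *chain of projective bundles* over $X$ is a finite (possibly empty) composition $P\to\cdots\to X$ of projections $\mathbb{P}(\mathcal{E})\to Q$ of projective bundles of finite rank locally free sheaves $\mathcal{E}$ of positive rank at every point. The chains over $X$ are directed by means of fibre products, and $$B(X)=\mathbb{Z}[R_X]\Big/\bigcup_{P\to X}\ker\bigl(\mathbb{Z}[R_X]\xrightarrow{\,f^*\,}\mathbb{Z}[R_P]\to\mathbb{Z}[R_P]/I_P\bigr),$$ the union being over all chains of projective bundles $f:P\to X$; that is, one divides by the kernel of the map from $\mathbb{Z}[R_X]$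 to the filtered colimit of the rings $\mathbb{Z}[R_P]/I_P$. Write $c_i^B(\mathcal{F})\in B(X)$ for the image of $c_i(\mathcal{F})$. The *total Chern class* is the group homomorphism $c_t^B:K(X)\to 1+tB(X)[[t]]$ determined by $c_t^B([\mathcal{F}])=1+c_1^B(\mathcal{F})t+c_2^B(\mathcal{F})t^2+\cdots$. **Proposition.** Let $X$ be a variety over $k$ with an ample invertible sheaf $\mathcal{L}$. Then for every finite rank locally free sheaf $\mathcal{F}$ on $X$ and every integer $i\ge1$, the Chern class $c_i^B(\mathcal{F})$ is nilpotent in $B(X)$. In particular, for every $x\in K(X)$ the total Chern class $c_t^B(x)$ is a polynomial in $t$. -/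

import Mathlib

open CategoryTheory CategoryTheory.Limits AlgebraicGeometry ZeroObject

universe u

noncomputable section

namespace ChernB

/-! ### Sheaves of modules on a scheme: unit, free sheaves, tensor products, local freeness -/

/-- The structure sheaf `𝒪_X` as a sheaf of modules over itself. -/
def structureSheaf (X : Scheme.{u}) : X.Modules :=
  SheafOfModules.unit.{u} X.ringCatSheaf

/-- The free sheaf `𝒪_X^{⊕ I}`. -/
def freeModule (X : Scheme.{u}) (I : Type u) : X.Modules :=
  SheafOfModules.free.{u} (R := X.ringCatSheaf) I

/-- The tensor product of sheaves of modules: the sheafification of the presheaf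
`U ↦ M(U) ⊗_{𝒪_X(U)} N(U)`. -/
def tensorModule {X : Scheme.{u}} (M N : X.Modules) : X.Modules :=
  (PresheafOfModules.sheafification (𝟙 X.ringCatSheaf.obj)).obj
    (PresheafOfModules.Monoidal.tensorObj (R := X.presheaf)
      ((Scheme.Modules.toPresheafOfModules X).obj M)
      ((Scheme.Modules.toPresheafOfModules X).obj N))

/-- The tensor powers `L^{⊗ n}`, with `L^{⊗ 0} = 𝒪_X`. -/
def tensorPower {X : Scheme.{u}} (L : X.Modules) : ℕ → X.Modules
  | 0 => structureSheaf X
  | n + 1 => tensorModule (tensorPower L n) L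

/-- `M` is free of rank `r` on some open neighbourhood of the point `x`. -/
def IsFreeNear {X : Scheme.{u}} (M : X.Modules) (x : X) (r : ℕ) : Prop :=
  ∃ U : X.Opens, x ∈ U ∧ Nonempty (M.restrict U.ι ≅ freeModule U (ULift.{u} (Fin r)))

/-- `M` is locally free of finite rank (the rank may vary with the point). -/
def IsLocallyFreeFinite {X : Scheme.{u}} (M : X.Modules) : Prop :=
  ∀ x : X, ∃ r : ℕ, IsFreeNear M x r

/-- `M` is an invertible sheaf, i.e. locally free of rank one. -/
def IsInvertibleSheaf {X : Scheme.{u}} (M : X.Modules) : Prop :=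
  ∀ x : X, IsFreeNear M x 1

lemma final_opensMap {X Y : TopCat.{u}} (f : X ⟶ Y) : (TopologicalSpace.Opens.map f).Final where
  out d := by
    have hT : IsTerminal (StructuredArrow.mk (S := d) (T := TopologicalSpace.Opens.map f)
        (Y := ⊤) (homOfLE le_top)) :=
      IsTerminal.ofUniqueHom (fun Z => StructuredArrow.homMk (homOfLE le_top) rfl)
        (fun Z m => StructuredArrow.hom_ext _ _ (Subsingleton.elim _ _))
    exact isConnected_of_isTerminal _ hT

lemma nonempty_pullback_free_iso {X Y : Scheme.{u}} (f : X ⟶ Y) (I : Type u) :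
    Nonempty ((Scheme.Modules.pullback f).obj (freeModule Y I) ≅ freeModule X I) :=
  haveI : (SheafOfModules.pushforward.{u} f.toRingCatSheafHom).IsRightAdjoint :=
    (Scheme.Modules.pullbackPushforwardAdjunction f).isRightAdjoint
  haveI : (TopologicalSpace.Opens.map f.base).Final := final_opensMap f.base
  ⟨SheafOfModules.pullbackObjFreeIso f.toRingCatSheafHom I⟩

lemma IsFreeNear.pullback {X Y : Scheme.{u}} (f : X ⟶ Y) {M : Y.Modules} {x : X} {r : ℕ}
    (h : IsFreeNear M (f x) r) :
    IsFreeNear ((Scheme.Modules.pullback f).obj M) x r := by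
  obtain ⟨U, hxU, ⟨e⟩⟩ := h
  refine ⟨f ⁻¹ᵁ U, hxU, ?_⟩
  obtain ⟨e'⟩ := nonempty_pullback_free_iso (f ∣_ U) (ULift.{u} (Fin r))
  exact ⟨(Scheme.Modules.restrictFunctorIsoPullback (f ⁻¹ᵁ U).ι).app _ ≪≫
    (Scheme.Modules.pullbackComp (f ⁻¹ᵁ U).ι f).app M ≪≫
    (Scheme.Modules.pullbackCongr (morphismRestrict_ι f U).symm).app M ≪≫
    (Scheme.Modules.pullbackComp (f ∣_ U) U.ι).symm.app M ≪≫
    (Scheme.Modules.pullback (f ∣_ U)).mapIso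
      ((Scheme.Modules.restrictFunctorIsoPullback U.ι).symm.app M ≪≫ e) ≪≫ e'⟩

/-- The class of finite rank locally free sheaves on `X`. -/
def LocFree (X : Scheme.{u}) : Type (u + 1) :=
  {M : X.Modules // IsLocallyFreeFinite M}

/-- Pullback of finite rank locally free sheaves along a morphism of schemes. -/
def LocFree.pullback {X Y : Scheme.{u}} (f : X ⟶ Y) (F : LocFree Y) : LocFree X :=
  ⟨(Scheme.Modules.pullback f).obj F.1, fun x => by
    obtain ⟨r, hr⟩ := F.2 (f x)
    exact ⟨r, hr.pullback f⟩⟩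

/-- `rk(F) < n`, at every point of `X`. -/
def LocFree.RankLT {X : Scheme.{u}} (F : LocFree X) (n : ℕ) : Prop :=
  ∀ x : X, ∃ r < n, IsFreeNear F.1 x r

/-- `F` has positive rank at every point of `X`. -/
def LocFree.RankPos {X : Scheme.{u}} (F : LocFree X) : Prop :=
  ∀ x : X, ∃ r, 0 < r ∧ IsFreeNear F.1 x r

/-- There is a short exact sequence `0 → E → G → F → 0` of sheaves of modules. -/
def IsShortExact {X : Scheme.{u}} (E G F : LocFree X) : Prop :=
  ∃ (i : E.1 ⟶ G.1) (p : G.1 ⟶ F.1) (w : i ≫ p = 0), (ShortComplex.mk i p w).ShortExact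

/-! ### Ample invertible sheaves -/

/-- `M` is generated by its global sections: it is a quotient of a free sheaf. -/
def IsGloballyGenerated {X : Scheme.{u}} (M : X.Modules) : Prop :=
  ∃ (I : Type u) (π : freeModule X I ⟶ M), Epi π

/-- Coherent sheaves on a noetherian scheme: quasi-coherent sheaves of finite type. -/
def IsCoherent {X : Scheme.{u}} (M : X.Modules) : Prop :=
  SheafOfModules.IsQuasicoherent.{u} (R := X.ringCatSheaf) M ∧
    SheafOfModules.IsFiniteType.{u} (R := X.ringCatSheaf) M

/-- An invertible sheaf `L` on a noetherian scheme `X` is ample if for every coherent sheaf `M`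
the sheaf `M ⊗ L^{⊗ n}` is generated by its global sections for all large `n`. -/
def IsAmple {X : Scheme.{u}} (L : X.Modules) : Prop :=
  IsInvertibleSheaf L ∧ ∀ M : X.Modules, IsCoherent M →
    ∃ n₀ : ℕ, ∀ n ≥ n₀, IsGloballyGenerated (tensorModule M (tensorPower L n))

/-! ### Projective bundles -/

/-- Given `p : P ⟶ X`, a morphism `q : p^* E ⟶ O₁` on `P` and a morphism `h : T ⟶ P` with
`h ≫ p = g`, this is the induced morphism `g^* E ≅ h^* p^* E ⟶ h^* O₁` on `T`. -/
def inducedQuotient {X P T : Scheme.{u}} {p : P ⟶ X} {E : X.Modules} {O₁ : P.Modules}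
    (q : (Scheme.Modules.pullback p).obj E ⟶ O₁) {g : T ⟶ X} (h : T ⟶ P) (w : h ≫ p = g) :
    (Scheme.Modules.pullback g).obj E ⟶ (Scheme.Modules.pullback h).obj O₁ :=
  (Scheme.Modules.pullbackCongr w).inv.app E ≫ (Scheme.Modules.pullbackComp h p).inv.app E ≫
    (Scheme.Modules.pullback h).map q

/-- `p : P ⟶ X` is (isomorphic to) the projective bundle `ℙ(E) ⟶ X`: there is a universal
invertible quotient `q : p^* E ⟶ 𝒪(1)` on `P`, so that `X`-morphisms `T ⟶ P` correspond to
isomorphism classes of invertible quotients of the pullback of `E` to `T`. -/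
def IsProjectiveBundle {X P : Scheme.{u}} (p : P ⟶ X) (E : X.Modules) : Prop :=
  ∃ (O₁ : P.Modules) (q : (Scheme.Modules.pullback p).obj E ⟶ O₁),
    IsInvertibleSheaf O₁ ∧ Epi q ∧
    ∀ (T : Scheme.{u}) (g : T ⟶ X) (L : T.Modules) (r : (Scheme.Modules.pullback g).obj E ⟶ L),
      IsInvertibleSheaf L → Epi r →
        ∃! h : T ⟶ P, ∃ w : h ≫ p = g,
          ∃ φ : (Scheme.Modules.pullback h).obj O₁ ≅ L, inducedQuotient q h w ≫ φ.hom = r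

/-- Chains of projective bundles: finite compositions `P ⟶ ⋯ ⟶ X` of projections from
successive projective bundles of finite rank locally free sheaves of positive rank. (The
projective bundle of the zero sheaf would be empty.) -/
inductive IsProjectiveChain : ∀ {P X : Scheme.{u}}, (P ⟶ X) → Prop
  | id (X : Scheme.{u}) : IsProjectiveChain (𝟙 X)
  | comp {P Q X : Scheme.{u}} (p : P ⟶ Q) (q : Q ⟶ X) (E : LocFree Q) (hE : E.RankPos)
      (hp : IsProjectiveBundle p E.1) (hq : IsProjectiveChain q) : IsProjectiveChain (p ≫ q)

/-! ### The ring `B(X)` -/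

/-- The polynomial ring `ℤ[R_X]` on the symbols `c_i(F)`, for `i ≥ 0` and `F` a finite rank
locally free sheaf on `X`. -/
abbrev SymbolRing (X : Scheme.{u}) : Type (u + 1) :=
  MvPolynomial (ℕ × LocFree X) ℤ

/-- The symbol `c_i(F)`. -/
def symbol {X : Scheme.{u}} (i : ℕ) (F : LocFree X) : SymbolRing X :=
  MvPolynomial.X (i, F)

/-- The generators of the ideal `I_X`. In the last clause `M` is any locally free sheaf isomorphic
to `L ⊗ L'`; isomorphic sheaves have congruent symbols by the Whitney relations. -/
inductive IsRelation (X : Scheme.{u}) : SymbolRing X → Prop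
  | zero (F : LocFree X) : IsRelation X (symbol 0 F - 1)
  | rank (F : LocFree X) (i : ℕ) (h : F.RankLT i) : IsRelation X (symbol i F)
  | whitney (E G F : LocFree X) (h : IsShortExact E G F) (i : ℕ) :
      IsRelation X (symbol i G - ∑ j ∈ Finset.range (i + 1), symbol (i - j) F * symbol j E)
  | add (L L' M : LocFree X) (hL : IsInvertibleSheaf L.1) (hL' : IsInvertibleSheaf L'.1)
      (e : M.1 ≅ tensorModule L.1 L'.1) :
      IsRelation X (symbol 1 M - symbol 1 L - symbol 1 L')

/-- The ideal `I_X ⊆ ℤ[R_X]`. -/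
def relIdeal (X : Scheme.{u}) : Ideal (SymbolRing X) :=
  Ideal.span {a | IsRelation X a}

/-- The pullback `ℤ[R_Y] → ℤ[R_X]`, `c_i(F) ↦ c_i(f^* F)`. -/
def symbolPullback {X Y : Scheme.{u}} (f : X ⟶ Y) : SymbolRing Y →+* SymbolRing X :=
  (MvPolynomial.rename fun s : ℕ × LocFree Y => (s.1, s.2.pullback f)).toRingHom

/-- The kernel of `ℤ[R_X] → colim_P ℤ[R_P] / I_P`, where `P ⟶ X` ranges over all chains of
projective bundles. These chains are directed (by fibre products over `X`), so the supremum of the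
kernels of the maps `ℤ[R_X] → ℤ[R_P] / I_P` is their union, which is the kernel of the map to the
colimit. -/
def chainKernel (X : Scheme.{u}) : Ideal (SymbolRing X) :=
  ⨆ (P : Scheme.{u}) (p : P ⟶ X) (_ : IsProjectiveChain p),
    RingHom.ker ((Ideal.Quotient.mk (relIdeal P)).comp (symbolPullback p))

/-- The ring `B(X)`. -/
abbrev B (X : Scheme.{u}) : Type (u + 1) :=
  SymbolRing X ⧸ chainKernel X

/-- The Chern class `c_i(F) ∈ B(X)` of a finite rank locally free sheaf. -/
def chernClass {X : Scheme.{u}} (i : ℕ) (F : LocFree X) : B X :=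
  Ideal.Quotient.mk (chainKernel X) (symbol i F)

/-! ### The Grothendieck group and the total Chern class -/

/-- The relations `[G] = [E] + [F]` for short exact sequences `0 → E → G → F → 0`. -/
def kRelations (X : Scheme.{u}) : AddSubgroup (FreeAbelianGroup (LocFree X)) :=
  AddSubgroup.closure {a | ∃ E G F : LocFree X, IsShortExact E G F ∧
    a = FreeAbelianGroup.of G - FreeAbelianGroup.of E - FreeAbelianGroup.of F}

/-- (The additive group of) the Grothendieck ring `K(X)` of finite rank locally free sheaves. -/
abbrev K (X : Scheme.{u}) : Type (u + 1) :=
  FreeAbelianGroup (LocFree X) ⧸ kRelations X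

/-- The class `[F] ∈ K(X)`. -/
def K.of {X : Scheme.{u}} (F : LocFree X) : K X :=
  QuotientAddGroup.mk' (kRelations X) (FreeAbelianGroup.of F)

lemma isZero_restrict {X U : Scheme.{u}} (f : U ⟶ X) [IsOpenImmersion f] {M : X.Modules}
    (h : IsZero M) : IsZero (M.restrict f) :=
  (Scheme.Modules.restrictFunctor f).map_isZero h

lemma isZero_freeModule_empty (X : Scheme.{u}) (I : Type u) [IsEmpty I] :
    IsZero (freeModule X I) := by
  have : IsInitial (freeModule X I) := by
    refine IsInitial.ofUniqueHom (fun M => (SheafOfModules.freeHomEquiv (R := X.ringCatSheaf) M).symm isEmptyElim) ?_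
    intro M f
    apply (SheafOfModules.freeHomEquiv (R := X.ringCatSheaf) M).injective
    exact Subsingleton.elim _ _
  exact (isZero_zero _).of_iso (this.uniqueUpToIso (isZero_zero _).isInitial)

lemma isFreeNear_zero {X : Scheme.{u}} {M : X.Modules} (h : IsZero M) (x : X) :
    IsFreeNear M x 0 :=
  ⟨⊤, trivial, ⟨(isZero_restrict _ h).iso (isZero_freeModule_empty _ _)⟩⟩

/-- The zero sheaf. -/
def LocFree.zero (X : Scheme.{u}) : LocFree X :=
  ⟨0, fun x => ⟨0, isFreeNear_zero (isZero_zero _) x⟩⟩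

lemma isShortExact_zero {X : Scheme.{u}} {F G : LocFree X} (e : G.1 ≅ F.1) :
    IsShortExact (LocFree.zero X) G F := by
  refine ⟨0, e.hom, by simp, ?_⟩
  have := (ShortComplex.Splitting.ofIsZeroOfIsIso (ShortComplex.mk (0 : (0 : X.Modules) ⟶ G.1) e.hom (by simp)) (isZero_zero _) inferInstance)
  exact this.shortExact

/-- Isomorphic sheaves have the same Chern symbols modulo `I_X`. -/
lemma symbol_congr {X : Scheme.{u}} {F G : LocFree X} (e : G.1 ≅ F.1) (i : ℕ) :
    Ideal.Quotient.mk (relIdeal X) (symbol i G) = Ideal.Quotient.mk (relIdeal X) (symbol i F) := by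
  have hmem : ∀ a, IsRelation X a → Ideal.Quotient.mk (relIdeal X) a = 0 := fun a ha =>
    Ideal.Quotient.eq_zero_iff_mem.2 (Ideal.subset_span ha)
  have h0 := hmem _ (.zero (LocFree.zero X))
  have hr : ∀ j, 0 < j → Ideal.Quotient.mk (relIdeal X) (symbol j (LocFree.zero X)) = 0 :=
    fun j hj => hmem _ (.rank _ _ fun x => ⟨0, hj, isFreeNear_zero (isZero_zero _) x⟩)
  have hw := hmem _ (.whitney _ _ _ (isShortExact_zero e) i)
  rw [map_sub, map_sum, sub_eq_zero, Finset.sum_eq_single_of_mem 0 (by simp)] at hw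
  · rw [map_sub, map_one, sub_eq_zero] at h0
    rw [hw, map_mul, h0, mul_one, Nat.sub_zero]
  · intro j _ hj
    rw [map_mul, hr j (Nat.pos_of_ne_zero hj), mul_zero]

lemma relIdeal_le_chainKernel (X : Scheme.{u}) : relIdeal X ≤ chainKernel X := by
  refine le_trans ?_ (le_iSup_of_le X (le_iSup_of_le (𝟙 X)
    (le_iSup_of_le (IsProjectiveChain.id X) le_rfl)))
  have h : (Ideal.Quotient.mk (relIdeal X)).comp (symbolPullback (𝟙 X)) =
      Ideal.Quotient.mk (relIdeal X) := by
    refine MvPolynomial.ringHom_ext (fun n => by simp) fun s => ?_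
    have := symbol_congr (F := s.2) (G := s.2.pullback (𝟙 X))
      ((Scheme.Modules.pullbackId X).app s.2.1) s.1
    simpa [symbolPullback, symbol] using this
  rw [h, Ideal.mk_ker]

lemma mk_eq_zero_of_isRelation {X : Scheme.{u}} {a : SymbolRing X} (ha : IsRelation X a) :
    Ideal.Quotient.mk (chainKernel X) a = 0 :=
  Ideal.Quotient.eq_zero_iff_mem.2 (relIdeal_le_chainKernel X (Ideal.subset_span ha))

/-- The group `1 + t R⟦t⟧` of power series with constant coefficient one. -/
abbrev OnePlus (R : Type*) [CommRing R] : Subgroup (PowerSeries R)ˣ :=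
  (Units.map (PowerSeries.constantCoeff (R := R) : PowerSeries R →* R)).ker

lemma constantCoeff_mk_chernClass {X : Scheme.{u}} (F : LocFree X) :
    PowerSeries.constantCoeff (PowerSeries.mk fun i => chernClass i F) = 1 := by
  have h := mk_eq_zero_of_isRelation (.zero F)
  rw [map_sub, map_one, sub_eq_zero] at h
  rw [← PowerSeries.coeff_zero_eq_constantCoeff_apply, PowerSeries.coeff_mk]
  exact h

/-- The total Chern class `1 + c_1(F) t + c_2(F) t² + ⋯` of a locally free sheaf. -/
def totalChernSheaf {X : Scheme.{u}} (F : LocFree X) : OnePlus (B X) :=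
  have h : IsUnit (PowerSeries.mk fun i => chernClass i F) :=
    PowerSeries.isUnit_iff_constantCoeff.2 (by rw [constantCoeff_mk_chernClass]; exact isUnit_one)
  ⟨h.unit, Units.ext (constantCoeff_mk_chernClass F)⟩

lemma totalChernSheaf_whitney {X : Scheme.{u}} {E G F : LocFree X} (h : IsShortExact E G F) :
    totalChernSheaf G = totalChernSheaf E * totalChernSheaf F := by
  refine Subtype.ext (Units.ext ?_)
  change (PowerSeries.mk fun i => chernClass i G) =
    (PowerSeries.mk fun i => chernClass i E) * (PowerSeries.mk fun i => chernClass i F)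
  ext i
  have hw := mk_eq_zero_of_isRelation (.whitney _ _ _ h i)
  rw [map_sub, map_sum, sub_eq_zero] at hw
  rw [PowerSeries.coeff_mul, PowerSeries.coeff_mk, chernClass, hw,
    Finset.Nat.sum_antidiagonal_eq_sum_range_succ_mk]
  refine Finset.sum_congr rfl fun j _ => ?_
  rw [map_mul, mul_comm, PowerSeries.coeff_mk, PowerSeries.coeff_mk]
  rfl

/-- The total Chern class homomorphism `c_t : K(X) → 1 + t B(X)⟦t⟧`, determined by
`c_t([F]) = 1 + c_1(F) t + c_2(F) t² + ⋯`. -/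
def totalChernHom (X : Scheme.{u}) : K X →+ Additive (OnePlus (B X)) :=
  QuotientAddGroup.lift (kRelations X)
    (FreeAbelianGroup.lift fun F => Additive.ofMul (totalChernSheaf F)) <| by
    rw [kRelations, AddSubgroup.closure_le]
    rintro _ ⟨E, G, F, h, rfl⟩
    simp [totalChernSheaf_whitney h, sub_sub]

/-- The total Chern class `c_t(x)` as a power series in `t` with coefficients in `B(X)`. -/
def totalChernClass {X : Scheme.{u}} (x : K X) : PowerSeries (B X) :=
  ((totalChernHom X x).toMul : (PowerSeries (B X))ˣ)

lemma totalChernClass_of {X : Scheme.{u}} (F : LocFree X) :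
    totalChernClass (K.of F) = PowerSeries.mk fun i => chernClass i F := by
  simp [totalChernClass, totalChernHom, K.of, totalChernSheaf]

end ChernB

end

/-!
In a commutative ring `B`, a polynomial with constant coefficient `1` is a unit of `B[t]` if and
only if its higher coefficients are nilpotent. The total Chern class of a locally free sheaf on a
quasi-compact scheme is a polynomial, so `F` has nilpotent Chern classes if and only if `c_t(F)` is
a unit of `B(X)[t]` (`hasNilpotentChern_iff`). As a divisor of a unit is a unit, in a short exact
sequence `0 → E → G → F → 0` of locally free sheaves the sheaf `G` has nilpotent Chern classes if
and only if both `E` and `F` do (`hasNilpotentChern_iff_of_shortExact`). As `c_t(𝒪_X) = 1`, all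
subbundles and quotient bundles of a free sheaf of finite rank have nilpotent Chern classes.

A globally generated locally free sheaf of finite rank on a quasi-compact scheme is a quotient of a
free sheaf of finite rank, with locally free kernel, so its Chern classes are nilpotent
(`hasNilpotentChern_of_isGloballyGenerated`). Given `F` and an ample `L`, choose `a` such that both
`N = L^{⊗ a}` and `F ⊗ N` are globally generated. Finitely many sections `s₁, …, sₙ` of `N` without
common zero define an injection `F → (F ⊗ N)ⁿ` with locally free cokernel: where `sₖ` does not
vanish, its component `F → F ⊗ N` is an isomorphism. As the Chern classes of `F ⊗ N`, hence of
`(F ⊗ N)ⁿ`, are nilpotent, so are those of `F` (`hasNilpotentChern_of_tensor`). The total Chern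
classes of elements of `K(X)` are quotients of the units `c_t(F)` of `B(X)[t]`, thus polynomials.

The sheaf theory is done with sections. `IsBasisOn M U e` says that the sections `e` of `M` over `U`
restrict to a basis over every open subset of `U`; kernels, cokernels and tensor products are
controlled by exhibiting bases of this kind (`exists_isBasisOn_kernel`, `isBasisOn_cokernel`,
`isBasisOn_tmul`), and `exists_finite_generators` extracts finitely many global sections, some of
which form a basis near any given point. Sheafification enters through the fact that its unit is
locally bijective, and epimorphisms of sheaves are shown to be locally surjective by mapping to the
sheafified quotient by the image (`exists_quotient`).
-/

noncomputable section

namespace ChernB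

open TopologicalSpace

/-! ### Sections of sheaves of modules -/

section Sections

variable {X : Scheme.{u}}

/-- Restriction of sections of a sheaf of modules, as an additive map. -/
def res (M : X.Modules) {U V : X.Opens} (h : V ≤ U) : Γ(M, U) →+ Γ(M, V) :=
  (M.presheaf.map (homOfLE h).op).hom

/-- Restriction of regular functions, as a ring homomorphism. -/
def resO {U V : X.Opens} (h : V ≤ U) : Γ(X, U) →+* Γ(X, V) :=
  (X.presheaf.map (homOfLE h).op).hom

lemma res_smul (M : X.Modules) {U V : X.Opens} (h : V ≤ U) (r : Γ(X, U)) (m : Γ(M, U)) :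
    res M h (r • m) = resO h r • res M h m :=
  Scheme.Modules.map_smul M (homOfLE h) r m

@[simp]
lemma res_self (M : X.Modules) {U : X.Opens} (h : U ≤ U) (m : Γ(M, U)) : res M h m = m :=
  congr($(M.presheaf.map_id (.op U)) m)

@[simp]
lemma res_res (M : X.Modules) {U V W : X.Opens} (h : V ≤ U) (h' : W ≤ V) (m : Γ(M, U)) :
    res M h' (res M h m) = res M (h'.trans h) m :=
  congr($(M.presheaf.map_comp (homOfLE h).op (homOfLE h').op) m).symm

/-- The map on sections over `U` of a morphism of sheaves of modules, as a linear map. -/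
def appL {M N : X.Modules} (f : M ⟶ N) (U : X.Opens) : Γ(M, U) →ₗ[Γ(X, U)] Γ(N, U) where
  toFun := f.app U
  map_add' := map_add (f.app U).hom
  map_smul' r m := f.app_smul r m

lemma appL_res {M N : X.Modules} (f : M ⟶ N) {U V : X.Opens} (h : V ≤ U) (m : Γ(M, U)) :
    appL f V (res M h m) = res N h (appL f U m) :=
  congr($(f.mapPresheaf.naturality (homOfLE h).op) m)

@[simp]
lemma appL_comp {M N K : X.Modules} (f : M ⟶ N) (g : N ⟶ K) (U : X.Opens) (m : Γ(M, U)) :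
    appL (f ≫ g) U m = appL g U (appL f U m) := rfl

@[simp]
lemma appL_id {M : X.Modules} (U : X.Opens) (m : Γ(M, U)) : appL (𝟙 M) U m = m := rfl

@[simp]
lemma appL_zero {M N : X.Modules} (U : X.Opens) (m : Γ(M, U)) :
    appL (0 : M ⟶ N) U m = 0 := rfl

@[simp]
lemma appL_add {M N : X.Modules} (f g : M ⟶ N) (U : X.Opens) (m : Γ(M, U)) :
    appL (f + g) U m = appL f U m + appL g U m := rfl

lemma appL_sum {M N : X.Modules} {ι : Type*} (s : Finset ι) (f : ι → (M ⟶ N)) (U : X.Opens)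
    (m : Γ(M, U)) : appL (∑ i ∈ s, f i) U m = ∑ i ∈ s, appL (f i) U m := by
  classical
  induction s using Finset.induction_on with
  | empty => simp
  | insert a s ha ih => rw [Finset.sum_insert ha, Finset.sum_insert ha, appL_add, ih]

lemma hom_ext_appL {M N : X.Modules} {f g : M ⟶ N} (h : ∀ U m, appL f U m = appL g U m) :
    f = g :=
  Scheme.Modules.hom_ext f g fun U => by ext m; exact h U m

lemma isIso_of_appL_bijective {M N : X.Modules} {f : M ⟶ N}
    (h : ∀ U, Function.Bijective (appL f U)) : IsIso f := by
  rw [Scheme.Modules.Hom.isIso_iff_isIso_app]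
  intro U
  exact (ConcreteCategory.isIso_iff_bijective (f.app U)).2 (h U)

lemma appL_bijective {M N : X.Modules} (f : M ⟶ N) [IsIso f] (U : X.Opens) :
    Function.Bijective (appL f U) :=
  (ConcreteCategory.isIso_iff_bijective (f.app U)).1 inferInstance

/-- A morphism of sheaves of modules from a compatible family of linear maps on sections. -/
def homMk {M N : X.Modules} (f : ∀ U : X.Opens, Γ(M, U) →ₗ[Γ(X, U)] Γ(N, U))
    (hf : ∀ {U V : X.Opens} (h : V ≤ U) (m : Γ(M, U)), f V (res M h m) = res N h (f U m)) :
    M ⟶ N :=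
  ⟨PresheafOfModules.homMk
    { app := fun U => AddCommGrpCat.ofHom (f U.unop).toAddMonoidHom
      naturality := fun U V i => by
        ext m
        exact hf (leOfHom i.unop) m }
    (fun U r m => (f U.unop).map_smul r m)⟩

@[simp]
lemma appL_homMk {M N : X.Modules} (f : ∀ U : X.Opens, Γ(M, U) →ₗ[Γ(X, U)] Γ(N, U))
    (hf : ∀ {U V : X.Opens} (h : V ≤ U) (m : Γ(M, U)), f V (res M h m) = res N h (f U m))
    (U : X.Opens) (m : Γ(M, U)) : appL (homMk f hf) U m = f U m := rfl

/-- Sections of a sheaf of modules which agree locally are equal. -/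
lemma section_ext (M : X.Modules) {U : X.Opens} {s t : Γ(M, U)}
    (h : ∀ x ∈ U, ∃ V : X.Opens, ∃ hV : V ≤ U, x ∈ V ∧ res M hV s = res M hV t) : s = t := by
  choose! V hV hx e using h
  refine TopCat.Sheaf.eq_of_locally_eq' ⟨M.presheaf, M.isSheaf⟩ (fun x : U => V x.1) U
    (fun x => homOfLE (hV x.1 x.2)) (fun x hxU => ?_) s t (fun x => e x.1 x.2)
  exact Opens.mem_iSup.2 ⟨⟨x, hxU⟩, hx x hxU⟩

/-- Regular functions which agree locally are equal. -/
lemma function_ext {U : X.Opens} {s t : Γ(X, U)}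
    (h : ∀ x ∈ U, ∃ V : X.Opens, ∃ hV : V ≤ U, x ∈ V ∧ resO hV s = resO hV t) : s = t := by
  choose! V hV hx e using h
  refine TopCat.Sheaf.eq_of_locally_eq' X.sheaf (fun x : U => V x.1) U
    (fun x => homOfLE (hV x.1 x.2)) (fun x hxU => ?_) s t (fun x => e x.1 x.2)
  exact Opens.mem_iSup.2 ⟨⟨x, hxU⟩, hx x hxU⟩

/-- Regular functions given locally, which agree on overlaps, glue. -/
lemma exists_glue {U : X.Opens} (V : U → X.Opens) (hV : ∀ x, V x ≤ U) (hx : ∀ x : U, x.1 ∈ V x)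
    (a : ∀ x, Γ(X, V x))
    (ha : ∀ x y, resO (inf_le_left : V x ⊓ V y ≤ V x) (a x) =
      resO (inf_le_right : V x ⊓ V y ≤ V y) (a y)) :
    ∃ b : Γ(X, U), ∀ x, resO (hV x) b = a x := by
  obtain ⟨b, hb, -⟩ := TopCat.Sheaf.existsUnique_gluing' X.sheaf V U
    (fun x => homOfLE (hV x)) (fun x hxU => Opens.mem_iSup.2 ⟨⟨x, hxU⟩, hx ⟨x, hxU⟩⟩) a
    (fun x y => ha x y)
  exact ⟨b, hb⟩

end Sections

/-! ### Bases of sections -/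

section Bases

variable {X : Scheme.{u}}

/-- The sections `e i` of `M` over `U` form a basis of `M|_U`: over every open `V ⊆ U`, each
section of `M` is uniquely a linear combination of the restrictions of the `e i`. -/
def IsBasisOn (M : X.Modules) (U : X.Opens) {ι : Type*} [Fintype ι] (e : ι → Γ(M, U)) : Prop :=
  ∀ (V : X.Opens) (h : V ≤ U),
    Function.Bijective fun a : ι → Γ(X, V) => ∑ i, a i • res M h (e i)

lemma IsBasisOn.restrict {M : X.Modules} {U V : X.Opens} {ι : Type*} [Fintype ι]
    {e : ι → Γ(M, U)} (he : IsBasisOn M U e) (h : V ≤ U) :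
    IsBasisOn M V fun i => res M h (e i) := by
  intro W hW
  simpa using he W (hW.trans h)

lemma IsBasisOn.reindex {M : X.Modules} {U : X.Opens} {ι κ : Type*} [Fintype ι] [Fintype κ]
    {e : ι → Γ(M, U)} (he : IsBasisOn M U e) (σ : κ ≃ ι) : IsBasisOn M U (e ∘ σ) := by
  intro V hV
  have := (he V hV).comp (Equiv.arrowCongr σ (Equiv.refl Γ(X, V))).bijective
  convert this using 2 with a
  rw [Function.comp_apply, ← σ.sum_comp]
  simp

/-- The basis of the module of sections over an open `V ⊆ U` given by a basis of `M|_U`. -/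
def IsBasisOn.basis {M : X.Modules} {U : X.Opens} {ι : Type*} [Fintype ι]
    {e : ι → Γ(M, U)} (he : IsBasisOn M U e) {V : X.Opens} (h : V ≤ U) :
    Module.Basis ι Γ(X, V) Γ(M, V) :=
  .ofEquivFun (LinearEquiv.ofBijective (Fintype.linearCombination Γ(X, V) fun i => res M h (e i))
    (he V h)).symm

lemma IsBasisOn.basis_apply {M : X.Modules} {U : X.Opens} {ι : Type*} [Fintype ι]
    {e : ι → Γ(M, U)} (he : IsBasisOn M U e) {V : X.Opens} (h : V ≤ U) (i : ι) :
    he.basis h i = res M h (e i) := by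
  classical
  rw [IsBasisOn.basis, Module.Basis.coe_ofEquivFun, LinearEquiv.symm_symm]
  exact (Fintype.linearCombination_apply_single _ _ _ _).trans (one_smul _ _)

/-- Being a basis can be checked by linear independence over every open subset, and local
generation: local coordinates glue by uniqueness. -/
lemma isBasisOn_of_locally {M : X.Modules} {U : X.Opens} {ι : Type*} [Fintype ι]
    {e : ι → Γ(M, U)}
    (inj : ∀ (V : X.Opens) (h : V ≤ U) (a : ι → Γ(X, V)), ∑ i, a i • res M h (e i) = 0 → a = 0)
    (surj : ∀ (V : X.Opens) (h : V ≤ U) (m : Γ(M, V)), ∀ x ∈ V, ∃ (W : X.Opens) (hW : W ≤ V),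
      x ∈ W ∧ ∃ a : ι → Γ(X, W), ∑ i, a i • res M (hW.trans h) (e i) = res M hW m) :
    IsBasisOn M U e := by
  have inj' : ∀ (V : X.Opens) (h : V ≤ U) (a b : ι → Γ(X, V)),
      ∑ i, a i • res M h (e i) = ∑ i, b i • res M h (e i) → a = b := by
    intro V h a b hab
    refine sub_eq_zero.1 (inj V h (a - b) ?_)
    simp [sub_smul, hab]
  intro V h
  refine ⟨fun a b hab => inj' V h a b hab, fun m => ?_⟩
  have key := surj V h m
  choose! W hW hx a ha using key
  have hglue : ∀ i, ∃ b : Γ(X, V), ∀ x : V, resO (hW x.1 x.2) b = a x.1 i := by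
    intro i
    refine exists_glue (fun x : V => W x.1) (fun x => hW x.1 x.2) (fun x => hx x.1 x.2)
      (fun x => a x.1 i) (fun x y => ?_)
    have := inj' (W x.1 ⊓ W y.1) ((inf_le_left.trans (hW x.1 x.2)).trans h)
      (fun i => resO inf_le_left (a x.1 i)) (fun i => resO inf_le_right (a y.1 i)) (by
        have h1 := congr(res M (inf_le_left : W x.1 ⊓ W y.1 ≤ W x.1) $(ha x.1 x.2))
        have h2 := congr(res M (inf_le_right : W x.1 ⊓ W y.1 ≤ W y.1) $(ha y.1 y.2))
        simp only [map_sum, res_smul, res_res] at h1 h2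
        rw [h1, h2])
    exact congrFun this i
  choose b hb using hglue
  refine ⟨b, section_ext M fun x hxV => ⟨W x, hW x hxV, hx x hxV, ?_⟩⟩
  simp only [map_sum, res_smul, res_res]
  rw [← ha x hxV]
  exact Finset.sum_congr rfl fun i _ => by rw [hb i ⟨x, hxV⟩]

/-- A morphism which is bijective on sections over small open sets is bijective on sections. -/
lemma appL_bijective_of_locally {M N : X.Modules} (f : M ⟶ N) {U : X.Opens}
    (h : ∀ x ∈ U, ∃ V : X.Opens, x ∈ V ∧ ∀ W ≤ V, Function.Bijective (appL f W)) :
    Function.Bijective (appL f U) := by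
  choose! V hx hV using h
  have inj : ∀ W ≤ U, Function.Injective (appL f W) := by
    intro W hW
    rw [injective_iff_map_eq_zero]
    intro m hm
    refine section_ext M fun x hxW => ⟨V x ⊓ W, inf_le_right, ⟨hx x (hW hxW), hxW⟩, ?_⟩
    apply (hV x (hW hxW) _ inf_le_left).1
    rw [appL_res, hm, map_zero, map_zero, map_zero]
  refine ⟨inj U le_rfl, fun n => ?_⟩
  have hs : ∀ x : U, ∃ m, appL f (V x.1 ⊓ U) m = res N inf_le_right n := fun x =>
    (hV x.1 x.2 _ inf_le_left).2 _
  choose m hm using hs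
  obtain ⟨s, hs, -⟩ := TopCat.Sheaf.existsUnique_gluing' ⟨M.presheaf, M.isSheaf⟩
    (fun x : U => V x.1 ⊓ U) U (fun x => homOfLE inf_le_right)
    (fun x hxU => Opens.mem_iSup.2 ⟨⟨x, hxU⟩, hx x hxU, hxU⟩) m (fun x y => by
      refine inj _ (inf_le_left.trans inf_le_right) ?_
      have h1 := appL_res f (inf_le_left : (V x.1 ⊓ U) ⊓ (V y.1 ⊓ U) ≤ _) (m x)
      have h2 := appL_res f (inf_le_right : (V x.1 ⊓ U) ⊓ (V y.1 ⊓ U) ≤ _) (m y)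
      rw [hm, res_res] at h1 h2
      exact h1.trans h2.symm)
  refine ⟨s, section_ext N fun x hxU => ⟨V x ⊓ U, inf_le_right, ⟨hx x hxU, hxU⟩, ?_⟩⟩
  rw [← appL_res, ← hm ⟨x, hxU⟩]
  exact congrArg _ (hs ⟨x, hxU⟩)

/-- A morphism carrying a basis over `U` to a basis is bijective on sections over subsets. -/
lemma IsBasisOn.appL_bijective {M N : X.Modules} (f : M ⟶ N) {U : X.Opens} {ι : Type*} [Fintype ι]
    {e : ι → Γ(M, U)} (he : IsBasisOn M U e) (hf : IsBasisOn N U fun i => appL f U (e i))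
    {V : X.Opens} (h : V ≤ U) : Function.Bijective (appL f V) := by
  rw [← Function.Bijective.of_comp_iff _ (he V h)]
  convert hf V h using 2 with a
  simp [appL_res]

/-- A morphism bijective on sections over subsets of `U` carries bases to bases. -/
lemma IsBasisOn.map {M N : X.Modules} (f : M ⟶ N) {U : X.Opens} {ι : Type*} [Fintype ι]
    {e : ι → Γ(M, U)} (he : IsBasisOn M U e) (hf : ∀ V ≤ U, Function.Bijective (appL f V)) :
    IsBasisOn N U fun i => appL f U (e i) := by
  intro V h
  convert (hf V h).comp (he V h) using 2 with a
  simp [appL_res]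

end Bases

/-! ### Local freeness in terms of bases of sections -/

section LocallyFree

variable {X : Scheme.{u}}

/-- The section `1` of the structure sheaf over `U`. -/
def unitSection (U : X.Opens) : Γ(structureSheaf X, U) := (1 : Γ(X, U))

lemma res_unitSection {U V : X.Opens} (h : V ≤ U) :
    res (structureSheaf X) h (unitSection U) = unitSection V :=
  map_one (resO h)

/-- Sections of the structure sheaf, seen as an `𝒪_X`-module, are regular functions. -/
def unitCoord (U : X.Opens) : Γ(structureSheaf X, U) ≃ₗ[Γ(X, U)] Γ(X, U) where
  toFun r := r
  invFun r := r
  map_add' _ _ := rfl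
  map_smul' _ _ := rfl

@[simp]
lemma unitCoord_unitSection (U : X.Opens) : unitCoord U (unitSection U) = 1 := rfl

lemma unitCoord_res {U V : X.Opens} (h : V ≤ U) (r : Γ(structureSheaf X, U)) :
    unitCoord V (res _ h r) = resO h (unitCoord U r) := rfl

@[simp]
lemma unitCoord_smul_unitSection {U : X.Opens} (r : Γ(structureSheaf X, U)) :
    unitCoord U r • unitSection U = r :=
  (unitCoord U).injective (by simp)

lemma isBasisOn_unitSection (U : X.Opens) :
    IsBasisOn (structureSheaf X) U fun _ : Unit => unitSection U := by
  intro V h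
  rw [← Function.Bijective.of_comp_iff' (unitCoord V).bijective]
  convert (Equiv.funUnique Unit Γ(X, V)).bijective using 1
  funext a
  simp [res_unitSection]

/-- The morphism `𝒪_X ⟶ M` given by a global section of `M`. -/
def ofSection {M : X.Modules} (m : Γ(M, ⊤)) : structureSheaf X ⟶ M :=
  homMk (fun U => (LinearMap.toSpanSingleton Γ(X, U) Γ(M, U) (res M le_top m)).comp
    (unitCoord U).toLinearMap) fun {U V} h r => by
      simp [unitCoord_res, res_smul]

lemma appL_ofSection {M : X.Modules} (m : Γ(M, ⊤)) (U : X.Opens) :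
    appL (ofSection m) U (unitSection U) = res M le_top m := one_smul _ _

lemma structureSheaf_hom_ext {M : X.Modules} {f g : structureSheaf X ⟶ M}
    (h : appL f ⊤ (unitSection ⊤) = appL g ⊤ (unitSection ⊤)) : f = g := by
  refine hom_ext_appL fun U m => ?_
  rw [← unitCoord_smul_unitSection m, map_smul, map_smul,
    ← res_unitSection (le_top : U ≤ ⊤), appL_res, appL_res, h]

/-- A finite direct sum decomposition `M ≅ ⨁ A i`, where each `A i` has a basis over `U`, gives a
basis of `M` over `U`. -/
lemma isBasisOn_of_total {M : X.Modules} {κ : Type*} [Fintype κ] [DecidableEq κ]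
    {A : κ → X.Modules} (i : ∀ k, A k ⟶ M) (p : ∀ k, M ⟶ A k)
    (hip : ∀ k, i k ≫ p k = 𝟙 _) (hip' : ∀ k l, k ≠ l → i k ≫ p l = 0)
    (tot : ∑ k, p k ≫ i k = 𝟙 M) {U : X.Opens}
    {ι : κ → Type*} [∀ k, Fintype (ι k)] {e : ∀ k, ι k → Γ(A k, U)}
    (he : ∀ k, IsBasisOn (A k) U (e k)) :
    IsBasisOn M U fun s : Σ k, ι k => appL (i s.1) U (e s.1 s.2) := by
  have hsum : ∀ (V : X.Opens) (h : V ≤ U) (a : (Σ k, ι k) → Γ(X, V)),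
      ∑ s, a s • res M h (appL (i s.1) U (e s.1 s.2)) =
        ∑ k, appL (i k) V (∑ j, a ⟨k, j⟩ • res (A k) h (e k j)) := by
    intro V h a
    simp [Fintype.sum_sigma, appL_res]
  have hp : ∀ (V : X.Opens) (l : κ) (m : ∀ k, Γ(A k, V)),
      appL (p l) V (∑ k, appL (i k) V (m k)) = m l := by
    intro V l m
    rw [map_sum, Finset.sum_eq_single l]
    · rw [← appL_comp, hip, appL_id]
    · intro k _ hk
      rw [← appL_comp, hip' k l hk, appL_zero]
    · simp
  intro V h
  refine ⟨fun a b hab => ?_, fun m => ?_⟩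
  · simp only [hsum] at hab
    ext ⟨k, j⟩
    have := congrArg (appL (p k) V) hab
    rw [hp, hp] at this
    exact congrFun ((he k V h).1 this) j
  · choose a ha using fun k => (he k V h).2 (appL (p k) V m)
    refine ⟨fun s => a s.1 s.2, ?_⟩
    simp only [hsum]
    simp only at ha
    simp only [ha, ← appL_comp, ← appL_sum, tot, appL_id]

/-- The inclusion of the `i`-th copy of `𝒪_X` in a free sheaf. -/
def freeι {I : Type u} (i : I) : structureSheaf X ⟶ freeModule X I :=
  SheafOfModules.ιFree (R := X.ringCatSheaf) i

/-- The morphism from a free sheaf given by a family of global sections. -/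
def freeDesc {M : X.Modules} {I : Type u} (f : I → (structureSheaf X ⟶ M)) : freeModule X I ⟶ M :=
  Cofan.IsColimit.desc (SheafOfModules.isColimitFreeCofan (R := X.ringCatSheaf) I) f

lemma freeι_freeDesc {M : X.Modules} {I : Type u} (f : I → (structureSheaf X ⟶ M)) (i : I) :
    freeι i ≫ freeDesc f = f i :=
  Cofan.IsColimit.fac (SheafOfModules.isColimitFreeCofan (R := X.ringCatSheaf) I) f i

lemma free_hom_ext {M : X.Modules} {I : Type u} {f g : freeModule X I ⟶ M}
    (h : ∀ i, freeι i ≫ f = freeι i ≫ g) : f = g :=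
  Cofan.IsColimit.hom_ext (SheafOfModules.isColimitFreeCofan (R := X.ringCatSheaf) I) _ _ h

/-- A free sheaf of finite rank has a basis of global sections. -/
lemma isBasisOn_free (X : Scheme.{u}) (I : Type u) [Fintype I] :
    IsBasisOn (freeModule X I) ⊤ fun i => appL (freeι i) ⊤ (unitSection ⊤) := by
  classical
  have := isBasisOn_of_total (M := freeModule X I) (fun i : I => freeι i)
    (fun i => freeDesc fun j => if j = i then 𝟙 _ else 0)
    (fun k => by simp [freeι_freeDesc]) (fun k l hkl => by simp [freeι_freeDesc, hkl])
    (free_hom_ext fun i => by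
      rw [Preadditive.comp_sum, Category.comp_id, Finset.sum_eq_single i]
      · rw [← Category.assoc, freeι_freeDesc, if_pos rfl, Category.id_comp]
      · intro j _ hj
        rw [← Category.assoc, freeι_freeDesc, if_neg hj.symm, zero_comp]
      · simp) (U := ⊤) (ι := fun _ => Unit) (e := fun _ _ => unitSection ⊤)
    (fun k => isBasisOn_unitSection ⊤)
  exact this.reindex ((Equiv.sigmaPUnit I).symm)

/-- Bases of the restriction of `M` along an open immersion are bases of `M`. -/
lemma isBasisOn_restrict_iff {U : Scheme.{u}} (f : U ⟶ X) [IsOpenImmersion f] (M : X.Modules)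
    (W : U.Opens) {ι : Type*} [Fintype ι] (e : ι → Γ(M, f ''ᵁ W)) :
    IsBasisOn (M.restrict f) W (fun i => (e i : Γ(M.restrict f, W))) ↔
      IsBasisOn M (f ''ᵁ W) e := by
  have key : ∀ (V : U.Opens) (h : V ≤ W),
      (fun a : ι → Γ(U, V) => ∑ i, a i • res (M.restrict f) h (e i)) =
      (fun a : ι → Γ(X, f ''ᵁ V) => ∑ i, a i • res M (f.image_mono h) (e i)) ∘
        (fun a i => (f.appIso V).inv.hom (a i)) := fun V h => rfl
  have hbij : ∀ V : U.Opens, Function.Bijective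
      (fun (a : ι → Γ(U, V)) i => (f.appIso V).inv.hom (a i)) := fun V =>
    (Equiv.arrowCongr (Equiv.refl ι)
      (f.appIso V).symm.commRingCatIsoToRingEquiv.toEquiv).bijective
  constructor
  · intro H V hV
    obtain ⟨V, rfl⟩ : ∃ V' : U.Opens, f ''ᵁ V' = V := by
      refine ⟨f ⁻¹ᵁ V, ?_⟩
      rw [f.image_preimage_eq_opensRange_inf]
      exact inf_eq_right.2 (hV.trans (f.image_le_opensRange W))
    have hV' : V ≤ W := (f.image_le_image_iff V W).1 hV
    have := H V hV'
    rw [key] at this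
    exact (Function.Bijective.of_comp_iff _ (hbij V)).1 this
  · intro H V hV
    rw [key]
    exact (H _ (f.image_mono hV)).comp (hbij V)

lemma IsFreeNear.exists_isBasisOn {M : X.Modules} {x : X} {r : ℕ} (h : IsFreeNear M x r) :
    ∃ U : X.Opens, x ∈ U ∧ ∃ e : Fin r → Γ(M, U), IsBasisOn M U e := by
  obtain ⟨U, hx, ⟨φ⟩⟩ := h
  have hb := (isBasisOn_free U (ULift.{u} (Fin r))).map φ.inv fun V _ => appL_bijective _ V
  refine ⟨U.ι ''ᵁ ⊤, by simpa using hx, _,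
    ((isBasisOn_restrict_iff U.ι M ⊤ _).1 hb).reindex Equiv.ulift.symm⟩

lemma IsBasisOn.isFreeNear {M : X.Modules} {U : X.Opens} {ι : Type*} [Fintype ι]
    {e : ι → Γ(M, U)} (he : IsBasisOn M U e) {x : X} (hx : x ∈ U) :
    IsFreeNear M x (Fintype.card ι) := by
  let σ : ULift.{u} (Fin (Fintype.card ι)) ≃ ι := Equiv.ulift.trans (Fintype.equivFin ι).symm
  have hU : U.ι ''ᵁ ⊤ ≤ U := by simp
  have h1 : IsBasisOn M (U.ι ''ᵁ ⊤) fun i => res M hU (e (σ i)) :=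
    (he.reindex σ).restrict hU
  let m : ULift.{u} (Fin (Fintype.card ι)) → Γ(M.restrict U.ι, ⊤) := fun i => res M hU (e (σ i))
  have h2 : IsBasisOn (M.restrict U.ι) ⊤ m := (isBasisOn_restrict_iff U.ι M ⊤ _).2 h1
  let f : freeModule U (ULift.{u} (Fin (Fintype.card ι))) ⟶ M.restrict U.ι :=
    freeDesc fun i => ofSection (m i)
  have hf : ∀ i, appL f ⊤ (appL (freeι i) ⊤ (unitSection ⊤)) = m i := by
    intro i
    rw [← appL_comp, freeι_freeDesc, appL_ofSection, res_self]
  have : IsIso f := isIso_of_appL_bijective fun V =>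
    (isBasisOn_free U _).appL_bijective f (by simpa only [hf] using h2) le_top
  exact ⟨U, hx, ⟨(asIso f).symm⟩⟩

lemma isLocallyFreeFinite_of_exists {M : X.Modules}
    (h : ∀ x : X, ∃ U : X.Opens, x ∈ U ∧ ∃ (ι : Type) (_ : Fintype ι) (e : ι → Γ(M, U)),
      IsBasisOn M U e) : IsLocallyFreeFinite M := by
  intro x
  obtain ⟨U, hx, ι, _, e, he⟩ := h x
  exact ⟨_, he.isFreeNear hx⟩

lemma isInvertibleSheaf_structureSheaf (X : Scheme.{u}) : IsInvertibleSheaf (structureSheaf X) :=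
  fun x => by simpa using (isBasisOn_unitSection (X := X) ⊤).isFreeNear (x := x) trivial

lemma IsInvertibleSheaf.isLocallyFreeFinite {M : X.Modules} (h : IsInvertibleSheaf M) :
    IsLocallyFreeFinite M := fun x => ⟨1, h x⟩

end LocallyFree

/-! ### Coherence of locally free sheaves -/

section Coherent

universe v₁ u₁

/-- A sheaf of modules on a site which is free of finite rank on the members of a cover is
quasi-coherent of finite type. -/
lemma quasicoherent_finiteType_of_cover {C : Type u₁} [Category.{v₁} C] {J : GrothendieckTopology C}
    {R : Sheaf J RingCat.{u}} [∀ X, HasSheafify (J.over X) AddCommGrpCat.{u}]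
    [∀ X, (J.over X).WEqualsLocallyBijective AddCommGrpCat.{u}] (M : SheafOfModules.{u} R)
    {I : Type*} (U : I → C) (hU : J.CoversTop U) (σ : I → Type u) [∀ i, Finite (σ i)]
    (φ : ∀ i, SheafOfModules.free (σ i) ≅ M.over (U i)) :
    M.IsQuasicoherent ∧ M.IsFiniteType := by
  let q : SheafOfModules.LocalGeneratorsData M :=
    { I := I
      X := U
      coversTop := hU
      generators := fun x => (SheafOfModules.free.generatingSections (σ x)).ofEpi (φ x).hom }
  have hq : q.IsLocallyFreeData := ⟨fun x => by
    change IsIso ((SheafOfModules.free.generatingSections (σ x)).ofEpi (φ x).hom).π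
    rw [SheafOfModules.GeneratingSections.ofEpi_π, SheafOfModules.free.generatingSections_π]
    exact IsIso.comp_isIso (f := 𝟙 (SheafOfModules.free (σ x))) (h := (φ x).hom)⟩
  have hf : q.shrink.IsFiniteType := ⟨fun x => ⟨inferInstanceAs (Finite (σ x.2.choose))⟩⟩
  exact ⟨q.quasiCoherentData.isQuasicoherent, ⟨q.shrink, hf⟩⟩

variable {X : Scheme.{u}}

lemma nonempty_free_iso_over {M : X.Modules} {U : X.Opens} {I : Type u}
    (e : M.restrict U.ι ≅ freeModule U I) :
    Nonempty (SheafOfModules.free I ≅ SheafOfModules.over (R := X.ringCatSheaf) M U) := by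
  let E := TopologicalSpace.Opens.sheafOfModulesEquivOver U X.ringCatSheaf
  have η : SheafOfModules.unit _ ≅ E.inverse.obj (SheafOfModules.unit _) :=
    (TopologicalSpace.Opens.sheafOfModulesEquivOverInverseUnit U X.ringCatSheaf).symm
  have : E.inverse.IsLeftAdjoint := E.symm.toAdjunction.isLeftAdjoint
  have : PreservesColimitsOfShape (Discrete I) E.inverse := inferInstance
  have e₁ : SheafOfModules.free I ≅ E.inverse.obj (SheafOfModules.free I) :=
    SheafOfModules.mapFreeIso E.inverse I η
  have e₂ : SheafOfModules.free I ≅ E.functor.obj (SheafOfModules.over (R := X.ringCatSheaf) M U) :=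
    e.symm ≪≫ ((Scheme.Modules.overFunctorEquiv U).app M).symm
  exact ⟨e₁ ≪≫ E.inverse.mapIso e₂ ≪≫ (E.unitIso.app _).symm⟩

lemma coversTop_of_mem (U : X → X.Opens) (hx : ∀ x, x ∈ U x) :
    (Opens.grothendieckTopology X).CoversTop U := by
  intro W x hxW
  exact ⟨W ⊓ U x, homOfLE inf_le_left, ⟨x, ⟨homOfLE inf_le_right⟩⟩, hxW, hx x⟩

lemma isCoherent_of_isLocallyFreeFinite {M : X.Modules} (h : IsLocallyFreeFinite M) :
    IsCoherent M := by
  choose r U hx e using h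
  exact quasicoherent_finiteType_of_cover (R := X.ringCatSheaf) M U (coversTop_of_mem U hx)
    (fun x => ULift.{u} (Fin (r x))) fun x => (nonempty_free_iso_over (e x).some).some

end Coherent

/-! ### Sheafification, locally on sections -/

section Sheafification

variable {X : Scheme.{u}}

instance (P : X.PresheafOfModules) (U : X.Opens) : Module Γ(X, U) (P.obj (.op U)) :=
  (P.obj (.op U)).isModule

/-- Restriction of sections of a presheaf of modules. -/
def pres (P : X.PresheafOfModules) {U V : X.Opens} (h : V ≤ U) :
    P.obj (.op U) →+ P.obj (.op V) :=
  (P.presheaf.map (homOfLE h).op).hom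

lemma pres_smul (P : X.PresheafOfModules) {U V : X.Opens} (h : V ≤ U) (r : Γ(X, U))
    (p : P.obj (.op U)) : pres P h (r • p) = resO h r • pres P h p :=
  P.map_smul (homOfLE h).op r p

lemma pres_pres (P : X.PresheafOfModules) {U V W : X.Opens} (h : V ≤ U) (h' : W ≤ V)
    (p : P.obj (.op U)) : pres P h' (pres P h p) = pres P (h'.trans h) p :=
  congr($(P.presheaf.map_comp (homOfLE h).op (homOfLE h').op) p).symm

/-- The sheaf associated with a presheaf of modules. -/
abbrev sheafify (P : X.PresheafOfModules) : X.Modules :=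
  (PresheafOfModules.sheafification (𝟙 X.ringCatSheaf.obj)).obj P

/-- The canonical map from the sections of a presheaf to those of its sheafification. -/
def toSheafify (P : X.PresheafOfModules) (U : X.Opens) :
    P.obj (.op U) →ₗ[Γ(X, U)] Γ(sheafify P, U) where
  toFun p := ((PresheafOfModules.sheafificationAdjunction (𝟙 X.ringCatSheaf.obj)).unit.app P).app
    (.op U) p
  map_add' := map_add (((PresheafOfModules.sheafificationAdjunction
    (𝟙 X.ringCatSheaf.obj)).unit.app P).app (.op U)).hom
  map_smul' r p := map_smul (((PresheafOfModules.sheafificationAdjunction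
    (𝟙 X.ringCatSheaf.obj)).unit.app P).app (.op U)).hom r p

lemma toSheafify_pres (P : X.PresheafOfModules) {U V : X.Opens} (h : V ≤ U) (p : P.obj (.op U)) :
    toSheafify P V (pres P h p) = res (sheafify P) h (toSheafify P U p) :=
  PresheafOfModules.naturality_apply
    ((PresheafOfModules.sheafificationAdjunction (𝟙 X.ringCatSheaf.obj)).unit.app P)
    (homOfLE h).op p

lemma toSheafify_locally_surjective (P : X.PresheafOfModules) {U : X.Opens}
    (s : Γ(sheafify P, U)) {x : X} (hx : x ∈ U) :
    ∃ (V : X.Opens) (h : V ≤ U), x ∈ V ∧ ∃ p, toSheafify P V p = res _ h s := by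
  obtain ⟨V, i, ⟨p, hp⟩, hxV⟩ := Presheaf.imageSieve_mem (Opens.grothendieckTopology X)
    (CategoryTheory.toSheafify (Opens.grothendieckTopology X) P.presheaf) s x hx
  exact ⟨V, leOfHom i, hxV, p, hp⟩

lemma toSheafify_locally_injective (P : X.PresheafOfModules) {U : X.Opens} {p : P.obj (.op U)}
    (hp : toSheafify P U p = 0) {x : X} (hx : x ∈ U) :
    ∃ (V : X.Opens) (h : V ≤ U), x ∈ V ∧ pres P h p = 0 := by
  obtain ⟨V, i, hi, hxV⟩ := Presheaf.equalizerSieve_mem (Opens.grothendieckTopology X)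
    (CategoryTheory.toSheafify (Opens.grothendieckTopology X) P.presheaf) p 0
      (hp.trans (map_zero (toSheafify P U)).symm) x hx
  refine ⟨V, leOfHom i, hxV, ?_⟩
  exact hi.trans (map_zero (pres P (leOfHom i)))

/-- A basis of a presheaf of modules over all open subsets of `U` is a basis of the associated
sheaf. -/
lemma isBasisOn_sheafify (P : X.PresheafOfModules) {U : X.Opens} {ι : Type*} [Fintype ι]
    (e : ι → P.obj (.op U))
    (h : ∀ (V : X.Opens) (hV : V ≤ U),
      Function.Bijective fun a : ι → Γ(X, V) => ∑ i, a i • pres P hV (e i)) :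
    IsBasisOn (sheafify P) U fun i => toSheafify P U (e i) := by
  have hsum : ∀ (V : X.Opens) (hV : V ≤ U) (a : ι → Γ(X, V)),
      ∑ i, a i • res (sheafify P) hV (toSheafify P U (e i)) =
        toSheafify P V (∑ i, a i • pres P hV (e i)) := by
    intro V hV a
    simp [toSheafify_pres]
  refine isBasisOn_of_locally (fun V hV a ha => ?_) (fun V hV m x hx => ?_)
  · rw [hsum] at ha
    funext i
    refine function_ext fun x hxV => ?_
    obtain ⟨W, hW, hxW, h0⟩ := toSheafify_locally_injective P ha hxV
    refine ⟨W, hW, hxW, ?_⟩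
    simp only [map_sum, pres_smul, pres_pres] at h0
    have := (h W (hW.trans hV)).1 (a₁ := fun i => resO hW (a i)) (a₂ := 0) (by simpa using h0)
    simpa using congrFun this i
  · obtain ⟨W, hW, hxW, p, hp⟩ := toSheafify_locally_surjective P m hx
    obtain ⟨a, ha⟩ := (h W (hW.trans hV)).2 p
    exact ⟨W, hW, hxW, a, by rw [hsum, ← hp, ← ha]⟩

end Sheafification

/-! ### Tensor products -/

section Tensor

variable {X : Scheme.{u}}

/-- The presheaf tensor product, whose associated sheaf is `tensorModule M N`. -/
abbrev preTensor (M N : X.Modules) : X.PresheafOfModules :=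
  PresheafOfModules.Monoidal.tensorObj (R := X.presheaf)
      ((Scheme.Modules.toPresheafOfModules X).obj M)
      ((Scheme.Modules.toPresheafOfModules X).obj N)

/-- Pure tensors of sections, before sheafification. -/
def preTmul (M N : X.Modules) (U : X.Opens) :
    Γ(M, U) →ₗ[Γ(X, U)] Γ(N, U) →ₗ[Γ(X, U)] (preTensor M N).obj (.op U) :=
  TensorProduct.mk Γ(X, U) Γ(M, U) Γ(N, U)

lemma pres_preTmul (M N : X.Modules) {U V : X.Opens} (h : V ≤ U) (m : Γ(M, U)) (n : Γ(N, U)) :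
    pres (preTensor M N) h (preTmul M N U m n) = preTmul M N V (res M h m) (res N h n) :=
  PresheafOfModules.Monoidal.tensorObj_map_tmul (R := X.presheaf) (homOfLE h).op m n

/-- Pure tensors of sections. -/
def tmul (M N : X.Modules) (U : X.Opens) :
    Γ(M, U) →ₗ[Γ(X, U)] Γ(N, U) →ₗ[Γ(X, U)] Γ(tensorModule M N, U) :=
  (preTmul M N U).compr₂ (toSheafify (preTensor M N) U)

lemma res_tmul (M N : X.Modules) {U V : X.Opens} (h : V ≤ U) (m : Γ(M, U)) (n : Γ(N, U)) :
    res (tensorModule M N) h (tmul M N U m n) = tmul M N V (res M h m) (res N h n) :=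
  (toSheafify_pres (preTensor M N) h (preTmul M N U m n)).symm.trans
    (congrArg (toSheafify (preTensor M N) V) (pres_preTmul M N h m n))

lemma isBasisOn_tmul {M N : X.Modules} {U : X.Opens} {ι κ : Type*} [Fintype ι] [Fintype κ]
    {e : ι → Γ(M, U)} {f : κ → Γ(N, U)} (he : IsBasisOn M U e) (hf : IsBasisOn N U f) :
    IsBasisOn (tensorModule M N) U fun s : ι × κ => tmul M N U (e s.1) (f s.2) := by
  refine isBasisOn_sheafify (preTensor M N) (fun s : ι × κ => preTmul M N U (e s.1) (f s.2))
    fun V hV => ?_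
  simp only [pres_preTmul]
  have key := ((he.basis hV).tensorProduct (hf.basis hV)).equivFun.symm.bijective
  have heq : ⇑((he.basis hV).tensorProduct (hf.basis hV)).equivFun.symm =
      fun a : ι × κ → Γ(X, V) =>
        ∑ s, a s • TensorProduct.mk Γ(X, V) _ _ (res M hV (e s.1)) (res N hV (f s.2)) := by
    funext a
    simp [Module.Basis.equivFun_symm_apply, Module.Basis.tensorProduct_apply',
      IsBasisOn.basis_apply]
  rw [heq] at key
  exact key

/-- The morphism `M ⟶ M ⊗ N`, `m ↦ m ⊗ n`, given by a global section `n` of `N`. -/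
def tensorRight (M : X.Modules) {N : X.Modules} (n : Γ(N, ⊤)) : M ⟶ tensorModule M N :=
  homMk (fun U => (tmul M N U).flip (res N le_top n)) fun {U V} h m => by
    simp [res_tmul]

/-- The morphism `N ⟶ M ⊗ N`, `n ↦ m ⊗ n`, given by a global section `m` of `M`. -/
def tensorLeft {M : X.Modules} (N : X.Modules) (m : Γ(M, ⊤)) : N ⟶ tensorModule M N :=
  homMk (fun U => tmul M N U (res M le_top m)) fun {U V} h n => by
    simp [res_tmul]

lemma appL_tensorLeft {M : X.Modules} (N : X.Modules) (m : Γ(M, ⊤)) (U : X.Opens) (n : Γ(N, U)) :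
    appL (tensorLeft N m) U n = tmul M N U (res M le_top m) n := rfl

lemma isLocallyFreeFinite_tensor {M N : X.Modules} (hM : IsLocallyFreeFinite M)
    (hN : IsLocallyFreeFinite N) : IsLocallyFreeFinite (tensorModule M N) := by
  refine isLocallyFreeFinite_of_exists fun x => ?_
  obtain ⟨r, hr⟩ := hM x
  obtain ⟨s, hs⟩ := hN x
  obtain ⟨U, hU, e, he⟩ := hr.exists_isBasisOn
  obtain ⟨V, hV, f, hf⟩ := hs.exists_isBasisOn
  exact ⟨U ⊓ V, ⟨hU, hV⟩, _, _, _,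
    isBasisOn_tmul (he.restrict inf_le_left) (hf.restrict inf_le_right)⟩

lemma isInvertibleSheaf_tensor {M N : X.Modules} (hM : IsInvertibleSheaf M)
    (hN : IsInvertibleSheaf N) : IsInvertibleSheaf (tensorModule M N) := by
  intro x
  obtain ⟨U, hU, e, he⟩ := (hM x).exists_isBasisOn
  obtain ⟨V, hV, f, hf⟩ := (hN x).exists_isBasisOn
  simpa using (isBasisOn_tmul (he.restrict inf_le_left) (hf.restrict inf_le_right)).isFreeNear
    (x := x) ⟨hU, hV⟩

lemma isInvertibleSheaf_tensorPower {L : X.Modules} (hL : IsInvertibleSheaf L) :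
    ∀ n, IsInvertibleSheaf (tensorPower L n)
  | 0 => isInvertibleSheaf_structureSheaf X
  | n + 1 => isInvertibleSheaf_tensor (isInvertibleSheaf_tensorPower hL n) hL

/-- For locally free `N`, tensoring with the section `1` is an isomorphism `N ≅ 𝒪_X ⊗ N`. -/
lemma isIso_tensorLeft_unit {N : X.Modules} (hN : IsLocallyFreeFinite N) :
    IsIso (tensorLeft N (unitSection (X := X) ⊤)) := by
  refine isIso_of_appL_bijective fun U => appL_bijective_of_locally _ fun x _ => ?_
  obtain ⟨r, hr⟩ := hN x
  obtain ⟨V, hV, e, he⟩ := hr.exists_isBasisOn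
  refine ⟨V, hV, fun W hW => he.appL_bijective _ ?_ hW⟩
  have := (isBasisOn_tmul (isBasisOn_unitSection V) he).reindex
    (Equiv.punitProd.{0} (Fin r)).symm
  simp only [appL_tensorLeft, res_unitSection]
  exact this

/-- Where the global section `n` is a basis of the invertible sheaf `N`, tensoring with `n` is
bijective on sections of a free sheaf. -/
lemma tensorRight_bijective {M N : X.Modules} {n : Γ(N, ⊤)} {U : X.Opens}
    (hn : IsBasisOn N U fun _ : Unit => res N le_top n) {ι : Type*} [Fintype ι]
    {e : ι → Γ(M, U)} (he : IsBasisOn M U e) {V : X.Opens} (h : V ≤ U) :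
    Function.Bijective (appL (tensorRight M n) V) := by
  refine he.appL_bijective _ ?_ h
  exact (isBasisOn_tmul he hn).reindex (Equiv.prodPUnit ι).symm

end Tensor

/-! ### Epimorphisms are locally surjective -/

section Epi

variable {X : Scheme.{u}}

/-- A presheaf of submodules `S` of `M` is, up to passing to smaller open sets, the kernel of a
morphism of sheaves: the one to the sheafification of the presheaf quotient `M / S`. -/
lemma exists_quotient (M : X.Modules)
    (S : ∀ U : X.Opens, Submodule Γ(X, U) Γ(M, U))
    (hS : ∀ {U V : X.Opens} (h : V ≤ U), ∀ m ∈ S U, res M h m ∈ S V) :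
    ∃ (Z : X.Modules) (q : M ⟶ Z),
      (∀ (U : X.Opens) (m : Γ(M, U)), m ∈ S U → appL q U m = 0) ∧
      (∀ (U : X.Opens) (m : Γ(M, U)), appL q U m = 0 → ∀ x ∈ U,
        ∃ (V : X.Opens) (h : V ≤ U), x ∈ V ∧ res M h m ∈ S V) := by
  let T : ((Scheme.Modules.toPresheafOfModules X).obj M).Submodule :=
    { obj := fun U => S U.unop
      map := fun i m hm => hS (leOfHom i.unop) m hm }
  let p := cokernel.π T.ι
  let g (U : X.Opens) : Γ(M, U) →ₗ[Γ(X, U)] (cokernel T.ι).obj (.op U) := (p.app (.op U)).hom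
  have hg : ∀ {U V : X.Opens} (h : V ≤ U) (m : Γ(M, U)), g V (res M h m) = pres _ h (g U m) :=
    fun h m => PresheafOfModules.naturality_apply p (homOfLE h).op m
  have h0 : ∀ (U : X.Opens) (m : Γ(M, U)), m ∈ S U → g U m = 0 := by
    intro U m hm
    exact ConcreteCategory.congr_hom ((PresheafOfModules.evaluation _ (.op U)).congr_map
      (cokernel.condition T.ι)) ⟨m, hm⟩
  have h1 : ∀ (U : X.Opens) (m : Γ(M, U)), g U m = 0 → m ∈ S U := by
    intro U m hm
    have hex : (ShortComplex.mk T.ι (cokernel.π T.ι) (cokernel.condition T.ι)).Exact :=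
      ShortComplex.exact_cokernel T.ι
    have hex' := hex.map (PresheafOfModules.evaluation X.ringCatSheaf.obj (.op U))
    obtain ⟨y, hy⟩ := (ShortComplex.moduleCat_exact_iff _).1 hex' m hm
    rw [← show T.ι.app (.op U) y = m from hy]
    exact y.2
  refine ⟨sheafify (cokernel T.ι), homMk (fun U => (toSheafify _ U).comp (g U)) ?_, ?_, ?_⟩
  · intro U V h m
    simp [hg, toSheafify_pres]
  · intro U m hm
    simp [h0 U m hm]
  · intro U m hm x hx
    obtain ⟨V, hV, hxV, e⟩ := toSheafify_locally_injective (cokernel T.ι) hm hx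
    exact ⟨V, hV, hxV, h1 V _ (by rw [hg, e])⟩

/-- If every morphism out of `M` which kills a presheaf of submodules `S` vanishes, then each
section of `M` lies locally in `S`. -/
lemma locally_mem_of_hom_eq_zero (M : X.Modules)
    (S : ∀ U : X.Opens, Submodule Γ(X, U) Γ(M, U))
    (hS : ∀ {U V : X.Opens} (h : V ≤ U), ∀ m ∈ S U, res M h m ∈ S V)
    (h : ∀ (Z : X.Modules) (q : M ⟶ Z),
      (∀ (U : X.Opens) (m : Γ(M, U)), m ∈ S U → appL q U m = 0) → q = 0)
    {U : X.Opens} (m : Γ(M, U)) {x : X} (hx : x ∈ U) :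
    ∃ (V : X.Opens) (h : V ≤ U), x ∈ V ∧ res M h m ∈ S V := by
  obtain ⟨Z, q, hq, hq'⟩ := exists_quotient M S hS
  exact hq' U m (by rw [h Z q hq, appL_zero]) x hx

/-- Epimorphisms of sheaves of modules are locally surjective. -/
lemma locally_surjective_of_epi {M N : X.Modules} (f : M ⟶ N) [Epi f] {U : X.Opens} (n : Γ(N, U))
    {x : X} (hx : x ∈ U) :
    ∃ (V : X.Opens) (h : V ≤ U), x ∈ V ∧ ∃ m, appL f V m = res N h n := by
  refine locally_mem_of_hom_eq_zero N (fun W => LinearMap.range (appL f W)) ?_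
    (fun Z q hq => ?_) n hx
  · rintro W W' h _ ⟨m, rfl⟩
    exact ⟨res M h m, appL_res f h m⟩
  · rw [← cancel_epi f, comp_zero]
    exact hom_ext_appL fun W m => hq W _ ⟨m, rfl⟩

/-- The global sections which define an epimorphism from a free sheaf generate locally. -/
lemma locally_mem_span_of_epi {M : X.Modules} {I : Type u} (f : freeModule X I ⟶ M) [Epi f]
    {U : X.Opens} (m : Γ(M, U)) {x : X} (hx : x ∈ U) :
    ∃ (V : X.Opens) (h : V ≤ U), x ∈ V ∧ res M h m ∈ Submodule.span Γ(X, V)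
      (Set.range fun i => res M (le_top : V ≤ ⊤) (appL (freeι i ≫ f) ⊤ (unitSection ⊤))) := by
  refine locally_mem_of_hom_eq_zero M
    (fun W => Submodule.span Γ(X, W) (Set.range fun i => res M (le_top : W ≤ ⊤)
        (appL (freeι i ≫ f) ⊤ (unitSection ⊤)))) ?_ (fun Z q hq => ?_) m hx
  · intro W W' h m hm
    induction hm using Submodule.span_induction with
    | mem m hm =>
      obtain ⟨j, rfl⟩ := hm
      exact Submodule.subset_span ⟨j, (res_res M le_top h _).symm⟩
    | zero => rw [map_zero]; exact zero_mem _
    | add _ _ _ _ h1 h2 => rw [map_add]; exact add_mem h1 h2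
    | smul r _ _ h1 => rw [res_smul]; exact Submodule.smul_mem _ _ h1
  · rw [← cancel_epi f, comp_zero]
    refine free_hom_ext fun i => structureSheaf_hom_ext ?_
    rw [comp_zero, appL_zero, ← Category.assoc, appL_comp]
    refine hq ⊤ _ (Submodule.subset_span ⟨i, ?_⟩)
    exact res_self _ _ _

/-- A morphism whose image contains, locally, all sections is an epimorphism. -/
lemma epi_of_locally_surjective {M N : X.Modules} (f : M ⟶ N)
    (h : ∀ x : X, ∃ V : X.Opens, x ∈ V ∧ ∀ W ≤ V, Function.Surjective (appL f W)) : Epi f := by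
  refine ⟨fun {Z} g g' hgg => hom_ext_appL fun U n => section_ext Z fun x hxU => ?_⟩
  obtain ⟨V, hxV, hV⟩ := h x
  obtain ⟨m, hm⟩ := hV (V ⊓ U) inf_le_left (res N inf_le_right n)
  refine ⟨V ⊓ U, inf_le_right, ⟨hxV, hxU⟩, ?_⟩
  rw [← appL_res, ← appL_res, ← hm, ← appL_comp, ← appL_comp, hgg]

end Epi

/-! ### Kernels and cokernels on sections -/

section Exact

variable {X : Scheme.{u}}

lemma appL_injective_of_mono {M N : X.Modules} (f : M ⟶ N) [Mono f] (U : X.Opens) :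
    Function.Injective (appL f U) := by
  have : Mono ((Scheme.Modules.toPresheafOfModules X).map f) := inferInstance
  exact PresheafOfModules.injective_of_mono ((Scheme.Modules.toPresheafOfModules X).map f) (.op U)

lemma mono_of_appL_injective {M N : X.Modules} (f : M ⟶ N)
    (h : ∀ U, Function.Injective (appL f U)) : Mono f :=
  ⟨fun {Z} g g' hgg => hom_ext_appL fun U n => h U (by rw [← appL_comp, ← appL_comp, hgg])⟩

/-- Taking sections is left exact. -/
lemma exists_of_shortExact {S : ShortComplex X.Modules} (hS : S.ShortExact) {U : X.Opens}
    (m : Γ(S.X₂, U)) (hm : appL S.g U m = 0) : ∃ k, appL S.f U k = m := by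
  let F := Scheme.Modules.toPresheafOfModules X ⋙
    PresheafOfModules.evaluation X.ringCatSheaf.obj (.op U)
  have : PreservesLimits (Scheme.Modules.toPresheafOfModules X) := inferInstance
  have : F.PreservesZeroMorphisms := ⟨fun _ _ => rfl⟩
  have : PreservesFiniteLimits F := comp_preservesFiniteLimits _ _
  have hex' := (hS.exact.map_of_mono_of_preservesKernel F hS.mono_f inferInstance)
  exact (ShortComplex.moduleCat_exact_iff _).1 hex' m hm

end Exact

/-! ### Bases of kernels and cokernels -/

section KernelBasis

variable {X : Scheme.{u}}

lemma sum_elim_smul_res {M : X.Modules} {U V : X.Opens} (h : V ≤ U) {τ κ : Type*} [Fintype τ]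
    [Fintype κ] (b : τ → Γ(M, U)) (c : κ → Γ(M, U)) (a : τ ⊕ κ → Γ(X, V)) :
    ∑ i, a i • res M h (Sum.elim b c i) =
      ∑ s, a (.inl s) • res M h (b s) + ∑ j, a (.inr j) • res M h (c j) := by
  simp [Fintype.sum_sum_type]

/-- A unitriangular change of basis. -/
lemma IsBasisOn.sub_sum_smul {M : X.Modules} {U : X.Opens} {τ κ : Type*} [Fintype τ] [Fintype κ]
    {b : τ → Γ(M, U)} {c : κ → Γ(M, U)} (h : IsBasisOn M U (Sum.elim b c))
    (a : κ → τ → Γ(X, U)) :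
    IsBasisOn M U (Sum.elim b fun j => c j - ∑ s, a j s • b s) := by
  intro V hV
  let E : (τ ⊕ κ → Γ(X, V)) ≃ (τ ⊕ κ → Γ(X, V)) :=
    { toFun := fun α => Sum.elim (fun s => α (.inl s) - ∑ j, α (.inr j) * resO hV (a j s))
        fun j => α (.inr j)
      invFun := fun α => Sum.elim (fun s => α (.inl s) + ∑ j, α (.inr j) * resO hV (a j s))
        fun j => α (.inr j)
      left_inv := fun α => by ext (s | j) <;> simp
      right_inv := fun α => by ext (s | j) <;> simp }
  convert (h V hV).comp E.bijective using 2 with α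
  simp only [Function.comp_apply, sum_elim_smul_res]
  simp only [E, Equiv.coe_fn_mk, Sum.elim_inl, Sum.elim_inr, map_sub, map_sum, res_smul, smul_sub,
    sub_smul, Finset.sum_sub_distrib, Finset.smul_sum, Finset.sum_smul, smul_smul]
  rw [Finset.sum_comm]
  abel

/-- Let `0 → X₁ → X₂ → X₃ → 0` be exact. If `b, c` is a basis of `X₂` such that `b` maps to a basis
of `X₃` and `c` maps to zero, then `c` is a basis of `X₁`. -/
lemma exists_isBasisOn_kernel_of_eq_zero {S : ShortComplex X.Modules} (hS : S.ShortExact)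
    {U : X.Opens} {τ κ : Type*} [Fintype τ] [Fintype κ] {b : τ → Γ(S.X₂, U)} {c : κ → Γ(S.X₂, U)}
    (h : IsBasisOn S.X₂ U (Sum.elim b c)) (hb : IsBasisOn S.X₃ U fun s => appL S.g U (b s))
    (hc : ∀ j, appL S.g U (c j) = 0) : ∃ k : κ → Γ(S.X₁, U), IsBasisOn S.X₁ U k := by
  choose k hk using fun j => exists_of_shortExact hS (c j) (hc j)
  have := hS.mono_f
  refine ⟨k, fun V hV => ?_⟩
  have hf : ∀ β : κ → Γ(X, V), appL S.f V (∑ j, β j • res _ hV (k j)) =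
      ∑ j, β j • res _ hV (c j) := by
    intro β
    simp [appL_res, hk]
  constructor
  · intro β β' hβ
    have h1 := congrArg (appL S.f V) hβ
    simp only [hf] at h1
    have h2 := (h V hV).1 (a₁ := Sum.elim 0 β) (a₂ := Sum.elim 0 β') (by
      simp only [sum_elim_smul_res]
      simpa using h1)
    funext j
    exact congrFun h2 (.inr j)
  · intro y
    obtain ⟨α, hα⟩ := (h V hV).2 (appL S.f V y)
    simp only [sum_elim_smul_res] at hα
    have h1 : ∑ s, α (.inl s) • res S.X₃ hV (appL S.g U (b s)) = 0 := by
      have h2 := congrArg (appL S.g V) hα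
      rw [← appL_comp S.f S.g, S.zero, appL_zero, map_add, map_sum, map_sum] at h2
      simpa [appL_res, hc] using h2
    have h2 := (hb V hV).1 (a₁ := fun s => α (.inl s)) (a₂ := 0) (by simpa using h1)
    refine ⟨fun j => α (.inr j), appL_injective_of_mono S.f V ?_⟩
    simp only [hf]
    rw [← hα]
    have h3 : ∀ s, α (.inl s) = 0 := congrFun h2
    simp [h3]

/-- Let `0 → X₁ → X₂ → X₃ → 0` be exact. If a part of a basis of `X₂` maps to a basis of `X₃`, then
`X₁` has a basis, indexed by the remaining part. -/
lemma exists_isBasisOn_kernel {S : ShortComplex X.Modules} (hS : S.ShortExact)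
    {U : X.Opens} {τ κ : Type*} [Fintype τ] [Fintype κ] {b : τ → Γ(S.X₂, U)} {c : κ → Γ(S.X₂, U)}
    (h : IsBasisOn S.X₂ U (Sum.elim b c)) (hb : IsBasisOn S.X₃ U fun s => appL S.g U (b s)) :
    ∃ k : κ → Γ(S.X₁, U), IsBasisOn S.X₁ U k := by
  choose a ha using fun j => (hb U le_rfl).2 (appL S.g U (c j))
  refine exists_isBasisOn_kernel_of_eq_zero hS (h.sub_sum_smul a) hb fun j => ?_
  rw [map_sub, ← ha j, map_sum, sub_eq_zero]
  simp

/-- Let `0 → X₁ → X₂ → X₃ → 0` be exact, and let `b, c` be a basis of `X₂` over `U`. If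
`ρ : X₂ ⟶ A` kills `c`, carries `b` to a basis, and is bijective on `X₁` over `U`, then `c` maps to
a basis of `X₃`. -/
lemma isBasisOn_cokernel {S : ShortComplex X.Modules} (hS : S.ShortExact)
    {U : X.Opens} {τ κ : Type*} [Fintype τ] [Fintype κ] {b : τ → Γ(S.X₂, U)} {c : κ → Γ(S.X₂, U)}
    (h : IsBasisOn S.X₂ U (Sum.elim b c)) {A : X.Modules} (ρ : S.X₂ ⟶ A)
    (hb : IsBasisOn A U fun s => appL ρ U (b s)) (hc : ∀ j, appL ρ U (c j) = 0)
    (hρ : ∀ V ≤ U, Function.Bijective (appL (S.f ≫ ρ) V)) :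
    IsBasisOn S.X₃ U fun j => appL S.g U (c j) := by
  have := hS.epi_g
  have hg : ∀ (V : X.Opens) (hV : V ≤ U) (β : κ → Γ(X, V)),
      ∑ j, β j • res _ hV (appL S.g U (c j)) = appL S.g V (∑ j, β j • res _ hV (c j)) := by
    intro V hV β
    simp [appL_res]
  have hρc : ∀ (V : X.Opens) (hV : V ≤ U) (β : κ → Γ(X, V)),
      appL ρ V (∑ j, β j • res _ hV (c j)) = 0 := by
    intro V hV β
    simp [appL_res, hc]
  refine isBasisOn_of_locally (fun V hV β hβ => ?_) (fun V hV n x hx => ?_)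
  · rw [hg] at hβ
    obtain ⟨y, hy⟩ := exists_of_shortExact hS _ hβ
    have hy0 : y = 0 := (hρ V hV).1 (by rw [appL_comp, hy, hρc, map_zero])
    rw [hy0, map_zero] at hy
    have h2 := (h V hV).1 (a₁ := Sum.elim 0 β) (a₂ := 0) (by
      simp only [sum_elim_smul_res]
      simpa using hy.symm)
    funext j
    exact congrFun h2 (.inr j)
  · obtain ⟨W, hW, hxW, m, hm⟩ := locally_surjective_of_epi S.g n hx
    have hWU := hW.trans hV
    obtain ⟨y, hy⟩ := (hρ W hWU).2 (appL ρ W m)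
    obtain ⟨α, hα⟩ := (h W hWU).2 (m - appL S.f W y)
    simp only [sum_elim_smul_res] at hα
    have h1 : ∑ s, α (.inl s) • res A hWU (appL ρ U (b s)) = 0 := by
      have h2 := congrArg (appL ρ W) hα
      rw [map_add, hρc, map_sub, ← appL_comp, hy, sub_self, add_zero, map_sum] at h2
      simpa [appL_res] using h2
    have h2 : ∀ s, α (.inl s) = 0 := congrFun
      ((hb W hWU).1 (a₁ := fun s => α (.inl s)) (a₂ := 0) (by simpa using h1))
    refine ⟨W, hW, hxW, fun j => α (.inr j), ?_⟩
    rw [hg, ← hm]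
    simp only [h2, zero_smul, Finset.sum_const_zero, zero_add] at hα
    rw [hα, map_sub, ← appL_comp, S.zero, appL_zero, sub_zero]

end KernelBasis

/-! ### Nilpotence of Chern classes and short exact sequences -/

section Nilpotent

variable {X : Scheme.{u}}

/-- All Chern classes of positive degree of `F` are nilpotent in `B(X)`. -/
def HasNilpotentChern (F : LocFree X) : Prop :=
  ∀ i, 1 ≤ i → IsNilpotent (chernClass i F)

lemma chernClass_zero (F : LocFree X) : chernClass 0 F = 1 := by
  simpa using constantCoeff_mk_chernClass F

lemma chernClass_eq_zero_of_rankLT {F : LocFree X} {i : ℕ} (h : F.RankLT i) :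
    chernClass i F = 0 :=
  mk_eq_zero_of_isRelation (.rank F i h)

/-- On a quasi-compact scheme the rank of a locally free sheaf is bounded. -/
lemma exists_rankLT [CompactSpace X] (F : LocFree X) : ∃ n, ∀ i ≥ n, F.RankLT i := by
  choose r U hx e using F.2
  obtain ⟨t, ht⟩ := isCompact_univ.elim_finite_subcover (fun x => (U x : Set X))
    (fun x => (U x).isOpen) fun x _ => Set.mem_iUnion.2 ⟨x, hx x⟩
  refine ⟨t.sup r + 1, fun i hi y => ?_⟩
  obtain ⟨x, hxt, hy⟩ := Set.mem_iUnion₂.1 (ht (Set.mem_univ y))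
  exact ⟨r x, lt_of_lt_of_le (Nat.lt_succ_of_le (Finset.le_sup hxt)) hi, U x, hy, e x⟩

/-- On a quasi-compact scheme the total Chern class of a locally free sheaf is a polynomial. -/
lemma exists_polynomial [CompactSpace X] (F : LocFree X) :
    ∃ p : Polynomial (B X), (∀ i, p.coeff i = chernClass i F) ∧
      (p : PowerSeries (B X)) = PowerSeries.mk fun i => chernClass i F := by
  obtain ⟨n, hn⟩ := exists_rankLT F
  have hp : ∀ i, (PowerSeries.trunc n (PowerSeries.mk fun i => chernClass i F)).coeff i =
      chernClass i F := by
    intro i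
    rw [PowerSeries.coeff_trunc]
    split_ifs with h
    · rw [PowerSeries.coeff_mk]
    · exact (chernClass_eq_zero_of_rankLT (hn i (not_lt.1 h))).symm
  refine ⟨_, hp, ?_⟩
  ext i
  rw [Polynomial.coeff_coe, hp, PowerSeries.coeff_mk]

/-- The Chern classes of positive degree are nilpotent if and only if the total Chern class is a
unit in the polynomial ring. -/
lemma hasNilpotentChern_iff {F : LocFree X} {p : Polynomial (B X)}
    (hp : ∀ i, p.coeff i = chernClass i F) : HasNilpotentChern F ↔ IsUnit p := by
  rw [Polynomial.isUnit_iff_coeff_isUnit_isNilpotent]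
  simp only [hp, chernClass_zero, isUnit_one, true_and, HasNilpotentChern,
    Nat.one_le_iff_ne_zero]

lemma isUnit_polynomial_mul_iff {R : Type*} [CommRing R] (p q : Polynomial R) :
    IsUnit (p * q) ↔ IsUnit p ∧ IsUnit q :=
  IsUnit.mul_iff

/-- A product of polynomials is a unit if and only if its factors are, so nilpotence of the Chern
classes can be checked on, and passes to, the outer terms of a short exact sequence. -/
lemma hasNilpotentChern_iff_of_shortExact [CompactSpace X] {E G F : LocFree X}
    (h : IsShortExact E G F) :
    HasNilpotentChern G ↔ HasNilpotentChern E ∧ HasNilpotentChern F := by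
  obtain ⟨pE, hE, hE'⟩ := exists_polynomial E
  obtain ⟨pG, hG, hG'⟩ := exists_polynomial G
  obtain ⟨pF, hF, hF'⟩ := exists_polynomial F
  have hmul : pG = pE * pF := by
    apply Polynomial.coe_injective
    rw [Polynomial.coe_mul, hE', hG', hF']
    exact congrArg (fun u : OnePlus (B X) => ((u : (PowerSeries (B X))ˣ) : PowerSeries (B X)))
      (totalChernSheaf_whitney h)
  rw [hasNilpotentChern_iff hE, hasNilpotentChern_iff hF, hasNilpotentChern_iff hG, hmul]
  exact isUnit_polynomial_mul_iff pE pF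

lemma hasNilpotentChern_congr {F G : LocFree X} (e : G.1 ≅ F.1) (h : HasNilpotentChern F) :
    HasNilpotentChern G := by
  intro i hi
  have : chernClass i G = chernClass i F := by
    have h1 := symbol_congr e i
    rw [Ideal.Quotient.eq] at h1
    exact Ideal.Quotient.eq.2 (relIdeal_le_chainKernel X h1)
  rw [this]
  exact h i hi

/-- The structure sheaf as a locally free sheaf. -/
def LocFree.structureSheaf (X : Scheme.{u}) : LocFree X :=
  ⟨ChernB.structureSheaf X, (isInvertibleSheaf_structureSheaf X).isLocallyFreeFinite⟩

/-- The first Chern class of `𝒪_X` vanishes because `𝒪_X ⊗ 𝒪_X ≅ 𝒪_X`. -/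
lemma hasNilpotentChern_structureSheaf (X : Scheme.{u}) :
    HasNilpotentChern (LocFree.structureSheaf X) := by
  have hO := isInvertibleSheaf_structureSheaf X
  intro i hi
  rcases hi.eq_or_lt with rfl | hi
  · have := isIso_tensorLeft_unit hO.isLocallyFreeFinite
    have e := asIso (tensorLeft (ChernB.structureSheaf X) (unitSection (X := X) ⊤))
    have h := mk_eq_zero_of_isRelation (.add (LocFree.structureSheaf X) (LocFree.structureSheaf X)
      (LocFree.structureSheaf X) hO hO e)
    rw [map_sub, map_sub, sub_self, zero_sub, neg_eq_zero] at h
    exact ⟨1, by rw [pow_one]; exact h⟩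
  · rw [chernClass_eq_zero_of_rankLT fun x => ⟨1, hi, hO x⟩]
    exact IsNilpotent.zero

lemma hasNilpotentChern_zero (X : Scheme.{u}) : HasNilpotentChern (LocFree.zero X) := by
  intro i hi
  rw [chernClass_eq_zero_of_rankLT fun x => ⟨0, hi, isFreeNear_zero (isZero_zero _) x⟩]
  exact IsNilpotent.zero

instance : HasFiniteBiproducts X.Modules := Abelian.hasFiniteBiproducts

/-- A basis of `A` over `U` gives a basis of the direct sum of `n` copies of `A`. -/
lemma isBasisOn_biproduct {A : X.Modules} (n : ℕ) {U : X.Opens} {κ : Type*} [Fintype κ]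
    {e : κ → Γ(A, U)} (he : IsBasisOn A U e) :
    IsBasisOn (⨁ fun _ : Fin n => A) U fun s : Σ _ : Fin n, κ =>
      appL (biproduct.ι (fun _ : Fin n => A) s.1) U (e s.2) :=
  isBasisOn_of_total (biproduct.ι fun _ : Fin n => A)
    (biproduct.π fun _ => A) (biproduct.ι_π_self _)
    (fun _ _ h => biproduct.ι_π_ne _ h) biproduct.total fun _ => he

/-- The direct sum of `n` copies of a locally free sheaf. -/
def LocFree.pow (A : LocFree X) (n : ℕ) : LocFree X :=
  ⟨⨁ fun _ : Fin n => A.1, isLocallyFreeFinite_of_exists fun x => by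
    obtain ⟨r, hr⟩ := A.2 x
    obtain ⟨U, hU, e, he⟩ := hr.exists_isBasisOn
    exact ⟨U, hU, _, _, _, isBasisOn_biproduct n he⟩⟩

/-- The split exact sequence `0 → A → Aⁿ⁺¹ → Aⁿ → 0`. -/
lemma exists_shortExact_biproduct_succ {C : Type*} [Category* C] [Preadditive C]
    [HasFiniteBiproducts C] [Balanced C] (A : C) (n : ℕ) :
    ∃ (i : A ⟶ ⨁ fun _ : Fin (n + 1) => A)
      (p : (⨁ fun _ : Fin (n + 1) => A) ⟶ ⨁ fun _ : Fin n => A) (w : i ≫ p = 0),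
      (ShortComplex.mk i p w).ShortExact := by
  let F : ∀ n, Fin n → C := fun _ _ => A
  let i : A ⟶ ⨁ F (n + 1) := biproduct.ι (F (n + 1)) 0
  let p : ⨁ F (n + 1) ⟶ ⨁ F n :=
    biproduct.lift fun k : Fin n => biproduct.π (F (n + 1)) k.succ
  have w : i ≫ p = 0 := by
    refine biproduct.hom_ext _ _ fun k => ?_
    rw [Category.assoc, biproduct.lift_π, zero_comp]
    exact biproduct.ι_π_ne (F (n + 1)) (Fin.succ_ne_zero k).symm
  refine ⟨i, p, w, ShortComplex.Splitting.shortExact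
    { r := biproduct.π (F (n + 1)) 0
      s := biproduct.desc fun k : Fin n => biproduct.ι (F (n + 1)) k.succ
      f_r := biproduct.ι_π_self (F (n + 1)) 0
      s_g := ?_
      id := ?_ }⟩
  · refine biproduct.hom_ext' _ _ fun k => biproduct.hom_ext _ _ fun l => ?_
    dsimp only [p]
    rw [biproduct.ι_desc_assoc, Category.assoc, biproduct.lift_π]
    by_cases h : k = l
    · subst h
      simp [F]
    · rw [biproduct.ι_π_ne _ (by simpa using h), Category.comp_id, biproduct.ι_π_ne _ h]
  · dsimp only [p]
    rw [biproduct.lift_desc, ← Fin.sum_univ_succ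
      (fun k => biproduct.π (F (n + 1)) k ≫ biproduct.ι (F (n + 1)) k)]
    exact biproduct.total

lemma isShortExact_pow_succ (A : LocFree X) (n : ℕ) :
    IsShortExact A (A.pow (n + 1)) (A.pow n) :=
  exists_shortExact_biproduct_succ A.1 n

lemma hasNilpotentChern_pow [CompactSpace X] {A : LocFree X} (hA : HasNilpotentChern A) (n : ℕ) :
    HasNilpotentChern (A.pow n) := by
  induction n with
  | zero =>
    have hz : IsZero (A.pow 0).1 := by
      rw [IsZero.iff_id_eq_zero]
      exact biproduct.hom_ext _ _ fun k => k.elim0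
    exact hasNilpotentChern_congr (hz.iso (isZero_zero _)) (hasNilpotentChern_zero X)
  | succ n ih => exact (hasNilpotentChern_iff_of_shortExact (isShortExact_pow_succ A n)).2 ⟨hA, ih⟩

end Nilpotent

/-! ### Finitely many global generators -/

section Generators

variable {X : Scheme.{u}}

/-- From a finite-dimensional spanning family one can extract a basis. -/
lemma exists_det_ne_zero {κ : Type*} [Field κ] {r : ℕ} {I : Type*} (v : I → Fin r → κ)
    (hv : Submodule.span κ (Set.range v) = ⊤) :
    ∃ a : Fin r → I, Function.Injective a ∧ (Matrix.of fun j => v (a j)).det ≠ 0 := by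
  obtain ⟨τ, a, ha, hspan, hli⟩ := exists_linearIndependent' κ v
  have b : Module.Basis τ κ (Fin r → κ) := .mk hli (by rw [hspan, hv])
  let σ : Fin r ≃ τ := (Pi.basisFun κ (Fin r)).indexEquiv b
  refine ⟨a ∘ σ, ha.comp σ.injective, ?_⟩
  have h : LinearIndependent κ (fun j => v (a (σ j))) := hli.comp σ σ.injective
  have := Matrix.linearIndependent_rows_iff_isUnit.1
    (show LinearIndependent κ (Matrix.of fun j => v (a (σ j))).row from h)
  exact ((Matrix.isUnit_iff_isUnit_det _).1 this).ne_zero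

lemma bijective_sum_smul_of_isUnit_det {R N ι : Type*} [CommRing R] [AddCommGroup N] [Module R N]
    [Fintype ι] [DecidableEq ι] {e f : ι → N}
    (he : Function.Bijective fun a : ι → R => ∑ i, a i • e i) (A : Matrix ι ι R)
    (hA : IsUnit A.det) (hf : ∀ j, f j = ∑ k, A j k • e k) :
    Function.Bijective fun a : ι → R => ∑ i, a i • f i := by
  have hu : IsUnit A := (Matrix.isUnit_iff_isUnit_det A).2 hA
  have hbij : Function.Bijective fun a : ι → R => Matrix.vecMul a A :=
    ⟨Matrix.vecMul_injective_of_isUnit hu, Matrix.vecMul_surjective_iff_isUnit.2 hu⟩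
  convert he.comp hbij using 2 with a
  simp only [Function.comp_apply, hf, Matrix.vecMul, dotProduct,
    Finset.smul_sum, Finset.sum_smul, smul_smul]
  rw [Finset.sum_comm]

lemma IsBasisOn.matrix {M : X.Modules} {U : X.Opens} {ι : Type*} [Fintype ι] [DecidableEq ι]
    {e f : ι → Γ(M, U)} (he : IsBasisOn M U e) (A : Matrix ι ι Γ(X, U)) (hA : IsUnit A.det)
    (hf : ∀ j, f j = ∑ k, A j k • e k) : IsBasisOn M U f := by
  intro V hV
  refine bijective_sum_smul_of_isUnit_det (he V hV) (A.map (resO hV)) ?_ fun j => ?_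
  · have := hA.map (resO hV)
    rwa [RingHom.map_det] at this
  · rw [hf, map_sum]
    exact Finset.sum_congr rfl fun k _ => res_smul M hV _ _

lemma exists_le_forall_mem (x : X) {ι : Type*} [Finite ι] (V : ι → X.Opens) (h : ∀ i, x ∈ V i)
    {U : X.Opens} (hU : x ∈ U) : ∃ W ≤ U, x ∈ W ∧ ∀ i, W ≤ V i := by
  obtain ⟨W, hW, hWo, hxW⟩ := mem_nhds_iff.1
    (Filter.iInter_mem.2 fun i => (V i).isOpen.mem_nhds (h i))
  exact ⟨⟨W, hWo⟩ ⊓ U, inf_le_right, ⟨hxW, hU⟩,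
    fun i => inf_le_left.trans fun y hy => Set.mem_iInter.1 (hW hy) i⟩

/-- Among global sections generating a locally free sheaf locally, some form a basis near a given
point: those whose values form a basis of the fibre. -/
lemma exists_isBasisOn_of_span {M : X.Modules} {I : Type*} (m : I → Γ(M, ⊤))
    (hm : ∀ (U : X.Opens) (n : Γ(M, U)), ∀ x ∈ U, ∃ (V : X.Opens) (h : V ≤ U), x ∈ V ∧
      res M h n ∈ Submodule.span Γ(X, V) (Set.range fun i => res M (le_top : V ≤ ⊤) (m i)))
    {x : X} {r : ℕ} (hr : IsFreeNear M x r) :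
    ∃ (a : Fin r → I) (W : X.Opens), Function.Injective a ∧ x ∈ W ∧
      IsBasisOn M W fun j => res M le_top (m (a j)) := by
  obtain ⟨U, hxU, e, he⟩ := hr.exists_isBasisOn
  choose V hVU hxV hV using fun k => hm U (e k) x hxU
  obtain ⟨W, hWU, hxW, hWV⟩ := exists_le_forall_mem x V hxV hxU
  let b := he.basis hWU
  -- `φ` takes the values at `x` of the coordinates with respect to `b`.
  let ev : Γ(X, W) →+* X.residueField x := (X.evaluation W x hxW).hom
  let φ : Γ(M, W) →ₛₗ[ev] (Fin r → X.residueField x) :=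
    { toFun := fun n k => ev (b.repr n k)
      map_add' := fun n n' => by ext k; simp
      map_smul' := fun c n => by ext k; simp }
  have hφe : ∀ k, φ (b k) = Pi.single k 1 := by
    intro k
    ext l
    simp [φ, Finsupp.single_apply, Pi.single_apply, eq_comm, apply_ite ev]
  have hspan : Submodule.span (X.residueField x)
      (Set.range fun i => φ (res M le_top (m i))) = ⊤ := by
    rw [eq_top_iff, ← (Pi.basisFun (X.residueField x) (Fin r)).span_eq, Submodule.span_le]
    rintro _ ⟨k, rfl⟩
    rw [Pi.basisFun_apply, ← hφe, IsBasisOn.basis_apply]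
    have h1 : res M hWU (e k) ∈ Submodule.span Γ(X, W)
        (Set.range fun i => res M (le_top : W ≤ ⊤) (m i)) := by
      rw [← res_res M (hVU k) (hWV k)]
      generalize res M (hVU k) (e k) = y, hV k = hy
      induction hy using Submodule.span_induction with
      | mem y hy =>
        obtain ⟨i, rfl⟩ := hy
        exact Submodule.subset_span ⟨i, (res_res M le_top (hWV k) _).symm⟩
      | zero => rw [map_zero]; exact zero_mem _
      | add _ _ _ _ h1 h2 => rw [map_add]; exact add_mem h1 h2
      | smul c _ _ h1 => rw [res_smul]; exact Submodule.smul_mem _ _ h1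
    generalize res M hWU (e k) = z at h1 ⊢
    induction h1 using Submodule.span_induction with
    | mem y hy =>
      obtain ⟨i, rfl⟩ := hy
      exact Submodule.subset_span ⟨i, rfl⟩
    | zero => rw [map_zero]; exact zero_mem _
    | add _ _ _ _ h1 h2 => rw [map_add]; exact add_mem h1 h2
    | smul c _ _ h1 => rw [map_smulₛₗ]; exact Submodule.smul_mem _ _ h1
  obtain ⟨a, ha, hdet⟩ := exists_det_ne_zero _ hspan
  let A : Matrix (Fin r) (Fin r) Γ(X, W) := Matrix.of fun j k => b.repr (res M le_top (m (a j))) k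
  have hA : ev A.det ≠ 0 := by
    rw [RingHom.map_det]
    exact hdet
  have hxA : x ∈ X.basicOpen A.det := (X.evaluation_ne_zero_iff_mem_basicOpen x hxW _).1 hA
  have hle : X.basicOpen A.det ≤ W := X.basicOpen_le _
  -- Over this open set the matrix of the chosen sections with respect to `b` is invertible.
  refine ⟨a, X.basicOpen A.det, ha, hxA, ?_⟩
  refine ((he.restrict hWU).restrict hle).matrix (A.map (resO hle)) ?_ fun j => ?_
  · have : IsUnit (resO hle A.det) := X.toRingedSpace.isUnit_res_basicOpen A.det
    rwa [RingHom.map_det] at this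
  · have h1 := congrArg (res M hle) (b.sum_repr (res M le_top (m (a j))))
    rw [res_res, map_sum] at h1
    rw [← h1]
    refine Finset.sum_congr rfl fun k _ => ?_
    rw [res_smul, IsBasisOn.basis_apply]
    rfl

/-- A globally generated locally free sheaf on a quasi-compact scheme has finitely many global
sections such that near each point some of them form a basis. -/
lemma exists_finite_generators [CompactSpace X] {M : X.Modules} (hM : IsGloballyGenerated M)
    (r : X → ℕ) (hr : ∀ x, IsFreeNear M x (r x)) :
    ∃ (n : ℕ) (s : Fin n → Γ(M, ⊤)), ∀ y : X, ∃ (x : X) (a : Fin (r x) → Fin n) (W : X.Opens),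
      Function.Injective a ∧ y ∈ W ∧ IsBasisOn M W fun j => res M le_top (s (a j)) := by
  classical
  obtain ⟨I, π, hπ⟩ := hM
  let m : I → Γ(M, ⊤) := fun i => appL (freeι i ≫ π) ⊤ (unitSection ⊤)
  choose a W ha hx hW using fun x => exists_isBasisOn_of_span m
    (fun U n x hxU => locally_mem_span_of_epi π n hxU) (hr x)
  obtain ⟨t, ht⟩ := isCompact_univ.elim_finite_subcover (fun x => (W x : Set X))
    (fun x => (W x).isOpen) fun x _ => Set.mem_iUnion.2 ⟨x, hx x⟩
  let T : Finset I := t.biUnion fun x => Finset.univ.image (a x)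
  refine ⟨T.card, fun k => m (T.equivFin.symm k), fun y => ?_⟩
  obtain ⟨x, hxt, hy⟩ := Set.mem_iUnion₂.1 (ht (Set.mem_univ y))
  have hT : ∀ j, a x j ∈ T := fun j => Finset.mem_biUnion.2
    ⟨x, hxt, Finset.mem_image.2 ⟨j, Finset.mem_univ _, rfl⟩⟩
  refine ⟨x, fun j => T.equivFin ⟨a x j, hT j⟩, W x, fun j j' h => ?_, hy, ?_⟩
  · exact ha x (congrArg Subtype.val (T.equivFin.injective h))
  · simpa using hW x

end Generators

/-! ### Nilpotence of the Chern classes -/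

section Main

variable {X : Scheme.{u}}

/-- A globally generated locally free sheaf is the quotient of a free sheaf of finite rank by a
locally free sheaf, so its Chern classes are nilpotent. -/
lemma hasNilpotentChern_of_isGloballyGenerated [CompactSpace X] {M : LocFree X}
    (hM : IsGloballyGenerated M.1) : HasNilpotentChern M := by
  classical
  choose r hr using M.2
  obtain ⟨n, s, hs⟩ := exists_finite_generators hM r hr
  let O : Fin n → X.Modules := fun _ => structureSheaf X
  let p : ⨁ O ⟶ M.1 := biproduct.desc fun k => ofSection (s k)
  have hp : ∀ k U, appL p U (appL (biproduct.ι O k) U (unitSection U)) = res M.1 le_top (s k) := by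
    intro k U
    rw [← appL_comp, biproduct.ι_desc, appL_ofSection]
  have hepi : Epi p := by
    refine epi_of_locally_surjective p fun y => ?_
    obtain ⟨x, a, W, ha, hyW, hb⟩ := hs y
    refine ⟨W, hyW, fun V hV m => ?_⟩
    obtain ⟨c, hc⟩ := (hb V hV).2 m
    refine ⟨∑ j, c j • appL (biproduct.ι O (a j)) V (unitSection V), ?_⟩
    simpa [hp] using hc
  let S : ShortComplex X.Modules := ShortComplex.mk (kernel.ι p) p (kernel.condition p)
  have hS : S.ShortExact := { exact := ShortComplex.exact_kernel p }
  have hK : IsLocallyFreeFinite (kernel p) := by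
    refine isLocallyFreeFinite_of_exists fun y => ?_
    obtain ⟨x, a, W, ha, hyW, hb⟩ := hs y
    have h1 := isBasisOn_biproduct n (isBasisOn_unitSection W)
    -- The basis vectors of the free sheaf which map to the basis of `M` given by `a` come first.
    have h2 := h1.reindex ((Equiv.sumCompl (· ∈ Set.range a)).trans
      (Equiv.sigmaPUnit (Fin n)).symm)
    rw [← Sum.elim_comp_inl_inr (_ ∘ _)] at h2
    refine ⟨W, hyW, _, _, exists_isBasisOn_kernel hS h2 ?_⟩
    convert hb.reindex (Equiv.ofInjective a ha).symm using 2 with k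
    have hk : a ((Equiv.ofInjective a ha).symm k) = k.1 := Equiv.apply_ofInjective_symm ha k
    exact (hp k.1 W).trans (by rw [Function.comp_apply, hk])
  exact ((hasNilpotentChern_iff_of_shortExact
    (E := ⟨kernel p, hK⟩) (G := (LocFree.structureSheaf X).pow n) (F := M)
    ⟨kernel.ι p, p, kernel.condition p, hS⟩).1
      (hasNilpotentChern_pow (hasNilpotentChern_structureSheaf X) n)).2

/-- If `N` is a globally generated invertible sheaf and the Chern classes of `F ⊗ N` are nilpotent,
then those of `F` are nilpotent: the sections of `N` embed `F` in a finite direct sum of copies of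
`F ⊗ N`, with locally free cokernel. -/
lemma hasNilpotentChern_of_tensor [CompactSpace X] {F A : LocFree X} {N : X.Modules}
    (hN : IsInvertibleSheaf N) (hN' : IsGloballyGenerated N) (hA : A.1 = tensorModule F.1 N)
    (hnil : HasNilpotentChern A) : HasNilpotentChern F := by
  classical
  obtain ⟨A, hAF⟩ := A
  obtain rfl : A = tensorModule F.1 N := hA
  obtain ⟨n, s, hs⟩ := exists_finite_generators hN' (fun _ => 1) hN
  let T : Fin n → X.Modules := fun _ => tensorModule F.1 N
  let i : F.1 ⟶ ⨁ T := biproduct.lift fun k => tensorRight F.1 (s k)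
  -- Near each point, one of the components of `i` is an isomorphism.
  have key : ∀ x : X, ∃ (k : Fin n) (V : X.Opens) (r : ℕ) (e : Fin r → Γ(T k, V)), x ∈ V ∧
      IsBasisOn (T k) V e ∧ ∀ W ≤ V, Function.Bijective (appL (i ≫ biproduct.π T k) W) := by
    intro x
    obtain ⟨_, a, W, -, hxW, hb⟩ := hs x
    obtain ⟨r, hr⟩ := F.2 x
    obtain ⟨U, hxU, e, he⟩ := hr.exists_isBasisOn
    have hb' := ((hb.reindex (Equiv.ofUnique Unit (Fin 1))).restrict
      (inf_le_left : W ⊓ U ≤ W))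
    simp only [Function.comp_apply, res_res] at hb'
    have he' := he.restrict (inf_le_right : W ⊓ U ≤ U)
    have hbij : ∀ V ≤ W ⊓ U, Function.Bijective (appL (tensorRight F.1 (s (a 0))) V) :=
      fun V hV => tensorRight_bijective hb' he' hV
    refine ⟨a 0, W ⊓ U, r, _, ⟨hxW, hxU⟩, he'.map _ hbij, ?_⟩
    rw [biproduct.lift_π]
    exact hbij
  have hmono : Mono i := by
    refine mono_of_appL_injective i fun U => (injective_iff_map_eq_zero _).2 fun m hm =>
      section_ext _ fun x hxU => ?_
    obtain ⟨k, V, -, -, hxV, -, hbij⟩ := key x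
    refine ⟨V ⊓ U, inf_le_right, ⟨hxV, hxU⟩, (hbij _ inf_le_left).1 ?_⟩
    rw [appL_comp, appL_res, hm, map_zero, map_zero, map_zero, map_zero]
  let S : ShortComplex X.Modules := ShortComplex.mk i (cokernel.π i) (cokernel.condition i)
  have hS : S.ShortExact := { exact := ShortComplex.exact_cokernel i }
  have hQ : IsLocallyFreeFinite (cokernel i) := by
    refine isLocallyFreeFinite_of_exists fun x => ?_
    obtain ⟨k, V, r, e, hxV, he, hbij⟩ := key x
    -- The basis vectors of the `k`-th summand, which `i` followed by `π k` hits, come first.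
    have h1 := (isBasisOn_biproduct n he).reindex
      (Equiv.sumCompl fun t : Σ _ : Fin n, Fin r => t.1 = k)
    rw [← Sum.elim_comp_inl_inr (_ ∘ _)] at h1
    have hself : ∀ l m, appL (biproduct.π T l) V (appL (biproduct.ι T l) V m) = m := fun l m => by
      rw [← appL_comp, biproduct.ι_π_self, appL_id]
    have hne : ∀ l, l ≠ k → ∀ m, appL (biproduct.π T k) V (appL (biproduct.ι T l) V m) = 0 :=
      fun l hl m => by rw [← appL_comp, biproduct.ι_π_ne T hl, appL_zero]
    refine ⟨V, hxV, _, _, _, isBasisOn_cokernel hS h1 (biproduct.π T k) ?_ ?_ hbij⟩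
    · let σ : {t : Σ _ : Fin n, Fin r // t.1 = k} ≃ Fin r :=
        { toFun := fun t => t.1.2
          invFun := fun j => ⟨⟨k, j⟩, rfl⟩
          left_inv := by rintro ⟨⟨_, j⟩, rfl⟩; rfl
          right_inv := fun j => rfl }
      convert he.reindex σ using 2 with t
      obtain ⟨⟨_, j⟩, rfl⟩ := t
      exact hself _ (e j)
    · rintro ⟨⟨l, j⟩, hl⟩
      exact hne l hl (e j)
  exact ((hasNilpotentChern_iff_of_shortExact
    (E := F) (G := LocFree.pow ⟨tensorModule F.1 N, hAF⟩ n) (F := ⟨cokernel i, hQ⟩)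
    ⟨i, cokernel.π i, cokernel.condition i, hS⟩).1 (hasNilpotentChern_pow hnil n)).1

/-- On a quasi-compact scheme with an ample invertible sheaf, all Chern classes are nilpotent. -/
lemma IsAmple.hasNilpotentChern [CompactSpace X] {L : X.Modules} (hL : IsAmple L) (F : LocFree X) :
    HasNilpotentChern F := by
  obtain ⟨hL, hgen⟩ := hL
  obtain ⟨n₁, h₁⟩ := hgen F.1 (isCoherent_of_isLocallyFreeFinite F.2)
  obtain ⟨n₂, h₂⟩ := hgen (structureSheaf X)
    (isCoherent_of_isLocallyFreeFinite (isInvertibleSheaf_structureSheaf X).isLocallyFreeFinite)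
  have hN := isInvertibleSheaf_tensorPower hL (max n₁ n₂)
  have hN' : IsGloballyGenerated (tensorPower L (max n₁ n₂)) := by
    obtain ⟨I, π, hπ⟩ := h₂ _ (le_max_right n₁ n₂)
    have := isIso_tensorLeft_unit hN.isLocallyFreeFinite
    exact ⟨I, π ≫ inv (tensorLeft (tensorPower L (max n₁ n₂)) (unitSection ⊤)), epi_comp _ _⟩
  exact hasNilpotentChern_of_tensor
    (A := ⟨_, isLocallyFreeFinite_tensor F.2 hN.isLocallyFreeFinite⟩) hN hN' rfl
    (hasNilpotentChern_of_isGloballyGenerated (h₁ _ (le_max_left n₁ n₂)))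

/-- If all Chern classes are nilpotent, then the total Chern classes of all elements of `K(X)` are
polynomials: the inverse of a polynomial with nilpotent higher coefficients is a polynomial. -/
lemma exists_polynomial_totalChernClass [CompactSpace X] (h : ∀ F : LocFree X, HasNilpotentChern F)
    (x : K X) : ∃ f : Polynomial (B X), totalChernClass x = (f : PowerSeries (B X)) := by
  suffices H : ∃ f : (Polynomial (B X))ˣ,
      totalChernClass x = ((f : Polynomial (B X)) : PowerSeries (B X)) from
    ⟨_, H.choose_spec⟩
  -- The power series which are units of the polynomial ring.
  let P : AddSubgroup (Additive (OnePlus (B X))) := AddSubgroup.comap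
    (MonoidHom.toAdditive (OnePlus (B X)).subtype)
    (Subgroup.toAddSubgroup (Units.map
      (Polynomial.coeToPowerSeries.ringHom (R := B X)).toMonoidHom).range)
  have hP : ∀ y : K X, totalChernHom X y ∈ P := by
    intro y
    obtain ⟨y, rfl⟩ := QuotientAddGroup.mk'_surjective (kRelations X) y
    let Q := P.comap ((totalChernHom X).comp (QuotientAddGroup.mk' (kRelations X)))
    change y ∈ Q
    induction y using FreeAbelianGroup.induction_on with
    | zero => exact Q.zero_mem
    | of F =>
      obtain ⟨p, hp, hp'⟩ := exists_polynomial F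
      obtain ⟨q, rfl⟩ := (hasNilpotentChern_iff hp).1 (h F)
      exact ⟨q, Units.ext (hp'.trans (totalChernClass_of F).symm)⟩
    | neg F hF => exact Q.neg_mem hF
    | add y z hy hz => exact Q.add_mem hy hz
  obtain ⟨f, hf⟩ := hP x
  exact ⟨f, (congrArg Units.val hf).symm⟩

end Main

end ChernB

end

/-- Let `X` be a variety over a field `k` (a separated `k`-scheme of finite type) with an ample
invertible sheaf `L`. Every Chern class `c_i(F)`, `i ≥ 1`, of a finite rank locally free sheaf `F`
on `X` is nilpotent in `B(X)`, and the total Chern class `c_t(x)` of every `x` in `K(X)` is a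
polynomial in `t`. -/
theorem proposition3p3 {k : Type u} [Field k] (X : Scheme.{u}) (s : X ⟶ Spec (CommRingCat.of k))
    [IsSeparated s] [LocallyOfFiniteType s] [QuasiCompact s]
    (L : X.Modules) (hL : ChernB.IsAmple L) :
    (∀ (F : ChernB.LocFree X) (i : ℕ), 1 ≤ i → IsNilpotent (ChernB.chernClass i F)) ∧
      (∀ x : ChernB.K X, ∃ f : Polynomial (ChernB.B X),
        ChernB.totalChernClass x = (f : PowerSeries (ChernB.B X))) := by
  have : CompactSpace X := QuasiCompact.compactSpace_of_compactSpace s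
  have h := hL.hasNilpotentChern
  exact ⟨h, ChernB.exists_polynomial_totalChernClass h⟩
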